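/- Consider a star DC network with source voltage $E>0$, line conductance $g_l>0$, and a finite set of loads $N=F\sqcup I$, where $F\neq\emptyset$ is the set of flexible loads and $I$ the (possibly empty) set of inflexible loads. The nominal demands satisfy $P_{0,i}\ge 0$ for $i\in F$ and $P_{0,i}>0$ for $i\in I$. For $g\in\mathbb{R}^N$ put $\bar g=\sum_{i\in N}g_i$, $v(\bar g)=\frac{E g_l}{\bar g+g_l}$, $P_i(g)=v(\bar g)^2g_i$, $\Delta P_i(g)=P_i(g)-P_{0,i}$, $\bar P_0=\sum_{i\in N}P_{0,i}$, $\overline{\Delta P}(\bar g)=\frac{(E g_l)^2}{(\bar g+g_l)^2}\,\bar g-\bar P_0$ and $P_{\max}=\frac{E^2g_l}{4}$. Let $\kappa_i>0$ for $i\in F$, $\bar\kappa=\sum_{i\in F}\kappa_i$, and $a,b>0$. The closed-loop system with the VCS controller, with state $(g,\phi,\hat g)\in\mathbb{R}^N\times\mathbb{R}\times\mathbb{R}^F$, is $$\dot g_i=-\Delta P_i(g)-\kappa_i\phi+b(\hat g_i-g_i)\ (i\in F),\qquad \dot g_i=-\Delta P_i(g)\ (i\in I),$$ $$\dot\phi=\overline{\Delta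 P}(\bar g)\,\frac{d\,\overline{\Delta P}}{d\bar g}(\bar g),\qquad \dot{\hat g}_i=-a(\hat g_i-g_i)\ (i\in F).$$ Let $\mathcal E_s$ (load satisfaction) be the set of $(g,\phi,\hat g)$ with $g\ge 0$, $\Delta P_i(g)=0$ for all $i\in N$, $\phi=0$ and $\hat g_i=g_i$ for $i\in F$. Let $\mathcal E_p$ (proportional allocation) be the set of $(g,\phi,\hat g)$ with $g\ge0$, $\Delta P_i(g)=\frac{\kappa_i}{\bar\kappa}(P_{\max}-\bar P_0)$ for $i\in F$, $\Delta P_i(g)=0$ for $i\in I$, $\phi=\frac{\bar P_0-P_{\max}}{\bar\kappa}$ and $\hat g_i=g_i$ for $i\in F$. Let $M=\{g\in\mathbb{R}^N: g\ge 0,\ \bar g<g_l\}$. Fix the network, the $\kappa_i$ and $b>0$. Then there is $a_0>0$ such that for every $a\in(0,a_0)$: 1. If $\bar P_0>P_{\max}$ and the flexible demand suffices for the required load shedding, i.e. $\frac{\kappa_i}{\bar\kappa}(\bar P_0-P_{\max})\le P_{0,i}$ for all $i\in F$ (equivalently, $\mathcal E_p\neq\emptyset$), then $\mathcal E_p$ consists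 of exactly one point, this point is the only equilibrium of the closed-loop system with $g\ge 0$, and it is locally asymptotically stable. 2. If $\bar P_0<P_{\max}$, then there is exactly one point $(g^*,\phi^*,\hat g^*)\in\mathcal E_s$ with $g^*\in\mathrm{cl}(M)$; it satisfies $g^*\in M$, i.e. $g^*\geq 0$ and $\sum_{i\in N} g^*_i<g_l$, and it is a locally asymptotically stable equilibrium of the closed-loop system. -/

import Mathlib

open Set Filter Topology

noncomputable section

namespace StarDC

/-- `x` is a solution on `[0, ∞)` of the autonomous differential equation `x' = f(x)`. -/
def IsForwardSolution {X : Type*} [NormedAddCommGroup X] [NormedSpace ℝ X]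
    (f : X → X) (x : ℝ → X) : Prop :=
  ∀ t : ℝ, 0 ≤ t → HasDerivWithinAt x (f (x t)) (Ici 0) t

/-- `p` is a locally asymptotically stable equilibrium of `x' = f(x)`: it is an equilibrium;
it is Lyapunov stable (all initial states close to `p` admit a solution on `[0, ∞)`, and all such
solutions stay close to `p`); and all solutions that start close enough to `p` converge to `p`. -/
def IsLocallyAsymptoticallyStable {X : Type*} [NormedAddCommGroup X] [NormedSpace ℝ X]
    (f : X → X) (p : X) : Prop :=
  f p = 0 ∧
  (∀ ε : ℝ, 0 < ε → ∃ δ : ℝ, 0 < δ ∧ ∀ x₀ : X, dist x₀ p < δ →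
    (∃ x : ℝ → X, x 0 = x₀ ∧ IsForwardSolution f x) ∧
    ∀ x : ℝ → X, x 0 = x₀ → IsForwardSolution f x → ∀ t : ℝ, 0 ≤ t → dist (x t) p < ε) ∧
  (∃ δ : ℝ, 0 < δ ∧ ∀ x : ℝ → X, dist (x 0) p < δ → IsForwardSolution f x →
    Tendsto x atTop (𝓝 p))

/-- The data of a star DC network with a finite set `F` of flexible loads and a finite set `I` of
inflexible loads; the set of all loads is the disjoint union `F ⊕ I`. -/
structure StarNetwork (F I : Type*) where
  /-- source voltage -/
  E : ℝ
  /-- conductance of the transmission line -/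
  gl : ℝ
  /-- nominal demand of each load -/
  P0 : F ⊕ I → ℝ
  /-- load shedding parameter of each flexible load -/
  κ : F → ℝ

/-- States `(g, φ, ĝ)`: the conductances of all loads, the shared state, and one auxiliary state
per flexible load. -/
abbrev State (F I : Type*) := (F ⊕ I → ℝ) × ℝ × (F → ℝ)

namespace StarNetwork

variable {F I : Type*} [Fintype F] [Fintype I] (S : StarNetwork F I)

/-- The total conductance `∑ i, g i`. -/
def totalConductance (g : F ⊕ I → ℝ) : ℝ := ∑ i, g i

/-- The load voltage `v = E g_l / (ḡ + g_l)` as a function of the total conductance. -/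
def voltage (gbar : ℝ) : ℝ := S.E * S.gl / (gbar + S.gl)

/-- The power `P_i(g) = v² g_i` consumed by load `i`. -/
def power (g : F ⊕ I → ℝ) (i : F ⊕ I) : ℝ := S.voltage (totalConductance g) ^ 2 * g i

/-- `ΔP_i(g) = P_i(g) - P_{0,i}`. -/
def deltaP (g : F ⊕ I → ℝ) (i : F ⊕ I) : ℝ := S.power g i - S.P0 i

/-- The total consumed power as a function of the total conductance. -/
def totalPower (gbar : ℝ) : ℝ := (S.E * S.gl) ^ 2 / (gbar + S.gl) ^ 2 * gbar

theorem sum_power (g : F ⊕ I → ℝ) : ∑ i, S.power g i = S.totalPower (totalConductance g) := by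
  simp only [power, totalPower, ← Finset.mul_sum, voltage, div_pow]
  rfl

/-- The total demand. -/
def totalDemand : ℝ := ∑ i, S.P0 i

/-- The difference between total consumed power and total demand, as a function of the total
conductance. -/
def totalDeltaP (gbar : ℝ) : ℝ := S.totalPower gbar - S.totalDemand

/-- The network capacity `P_max = E² g_l / 4`. -/
def Pmax : ℝ := S.E ^ 2 * S.gl / 4

/-- The sum of the load shedding parameters. -/
def κbar : ℝ := ∑ i, S.κ i

/-- The right-hand side of the closed-loop dynamics with the VCS controller. -/
def vcsField (a b : ℝ) : State F I → State F I := fun x =>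
  (Sum.elim
    (fun i => -S.deltaP x.1 (Sum.inl i) - S.κ i * x.2.1 + b * (x.2.2 i - x.1 (Sum.inl i)))
    (fun j => -S.deltaP x.1 (Sum.inr j)),
   S.totalDeltaP (totalConductance x.1) * deriv S.totalDeltaP (totalConductance x.1),
   fun i => -a * (x.2.2 i - x.1 (Sum.inl i)))

/-- The equilibria of the closed loop with nonnegative conductances. -/
def equilibria (a b : ℝ) : Set (State F I) :=
  {x | (∀ i, 0 ≤ x.1 i) ∧ S.vcsField a b x = 0}

/-- The load satisfaction set. -/
def loadSatisfaction : Set (State F I) :=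
  {x | (∀ i, 0 ≤ x.1 i) ∧ (∀ i, S.deltaP x.1 i = 0) ∧ x.2.1 = 0 ∧
    ∀ i, x.2.2 i = x.1 (Sum.inl i)}

/-- The proportional allocation set. -/
def proportionalAllocation : Set (State F I) :=
  {x | (∀ i, 0 ≤ x.1 i) ∧
    (∀ i, S.deltaP x.1 (Sum.inl i) = S.κ i / S.κbar * (S.Pmax - S.totalDemand)) ∧
    (∀ j, S.deltaP x.1 (Sum.inr j) = 0) ∧
    x.2.1 = (S.totalDemand - S.Pmax) / S.κbar ∧
    ∀ i, x.2.2 i = x.1 (Sum.inl i)}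

/-- The conductance vectors `g ≥ 0` with total conductance below `g_l`. -/
def regionM : Set (F ⊕ I → ℝ) := {g | (∀ i, 0 ≤ g i) ∧ totalConductance g < S.gl}

end StarNetwork

end StarDC

end

/-! Existence and uniqueness of the equilibria follow from the power curve. `Pmax - totalPower` is a
perfect square vanishing only at total conductance `gl`. If demand exceeds capacity, the shared
state can rest only where the slope vanishes, that is at `gl`; summing the load equations then fixes
`φ`, and the known voltage fixes every `g i`. If demand is below capacity, the intermediate value
theorem and injectivity of the curve below `gl` give the unique satisfying point.

Stability comes from Lyapunov's indirect method with a quadratic form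
(`isLocallyAsymptoticallyStable_of_quadratic`). The linearization is a cascade. The total
conductance `G`, the inflexible conductance `z`, the filter sum `U` and `η = κ̄ φ - b U` obey a
closed linear system, and they drive the individual loads, whose own dynamics are dissipative. So a
large multiple of a form for the aggregates plus a diagonal form for the loads works
(`exists_quadratic_lyapunov`).

For the aggregates, small `a` makes `U` slow. With `U` frozen, `(G, z, η)` has a strictly decaying
form (`fast_subsystem_lyapunov`), and adding `U ^ 2` survives the `O(a)` coupling
(`aggregate_lyapunov`). This uses two facts: the sensitivities `s i` sum to at most the squared
voltage, which means total conductance at most `gl`; and the derivative `sharedGain` of `ΔP ΔP'` is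
positive. That derivative is `ΔP'²` at load satisfaction, and a product of two negative factors `ΔP
ΔP''` at proportional allocation. -/

noncomputable section

namespace StarDC

/-! ### Global solutions of bounded Lipschitz fields -/

section GlobalExistence

variable {X : Type*} [NormedAddCommGroup X] [NormedSpace ℝ X]

/-- A bounded Lipschitz autonomous vector field has a forward solution from every point. -/
theorem exists_isForwardSolution_of_lipschitzWith_of_bounded [CompleteSpace X] {f : X → X}
    {K L : NNReal} (hK : LipschitzWith K f) (hL : ∀ x, ‖f x‖ ≤ L) (x₀ : X) :
    ∃ x : ℝ → X, x 0 = x₀ ∧ IsForwardSolution f x := by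
  have key : ∀ n : ℕ, ∃ α : ℝ → X, α 0 = x₀ ∧
      ∀ t ∈ Icc (0 : ℝ) n, HasDerivWithinAt α (f (α t)) (Icc (0 : ℝ) n) t := by
    intro n
    have h0 : (0 : ℝ) ∈ Icc (0 : ℝ) n := ⟨le_rfl, n.cast_nonneg⟩
    -- Speed at most `L` cannot leave the ball of radius `L * n` within time `n`, so one
    -- Picard–Lindelöf step covers all of `[0, n]`.
    have hp : IsPicardLindelof (fun _ : ℝ => f) (⟨0, h0⟩ : Icc (0 : ℝ) n) x₀ (L * n) 0 L K := by
      refine IsPicardLindelof.of_time_independent (fun x _ => hL x) hK.lipschitzOnWith ?_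
      simp
    obtain ⟨α, hα, hα'⟩ := hp.exists_eq_forall_mem_Icc_hasDerivWithinAt₀
    exact ⟨α, hα, hα'⟩
  choose α hα0 hα using key
  have hright : ∀ n : ℕ, ∀ t ∈ Ico (0 : ℝ) n, HasDerivWithinAt (α n) (f (α n t)) (Ici t) t := by
    intro n t ht
    refine (hα n t ⟨ht.1, ht.2.le⟩).mono_of_mem_nhdsWithin ?_
    exact mem_of_superset (Icc_mem_nhdsGE ht.2) (Icc_subset_Icc_left ht.1)
  have hcont : ∀ n : ℕ, ContinuousOn (α n) (Icc (0 : ℝ) n) :=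
    fun n t ht => (hα n t ht).continuousWithinAt
  have agree : ∀ m n : ℕ, m ≤ n → EqOn (α m) (α n) (Icc (0 : ℝ) m) := by
    intro m n hmn
    have hmn' : (m : ℝ) ≤ n := Nat.cast_le.2 hmn
    exact ODE_solution_unique (v := fun _ => f) (fun _ => hK) (hcont m) (hright m)
      ((hcont n).mono (Icc_subset_Icc_right hmn'))
      (fun t ht => hright n t ⟨ht.1, ht.2.trans_le hmn'⟩) (by rw [hα0, hα0])
  have agree' : ∀ m n : ℕ, ∀ t : ℝ, 0 ≤ t → t ≤ m → t ≤ n → α m t = α n t := by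
    intro m n t h0 hm hn
    rcases le_total m n with h | h
    · exact agree m n h ⟨h0, hm⟩
    · exact (agree n m h ⟨h0, hn⟩).symm
  -- The `+ 1` keeps `t` strictly below the right end of its interval, so the two-sided derivative
  -- survives the gluing.
  refine ⟨fun t => α (⌈t⌉₊ + 1) t, hα0 _, fun t ht => ?_⟩
  set N := ⌈t⌉₊ + 1 with hN
  have htN : t < N := (Nat.le_ceil t).trans_lt (by rw [hN]; push_cast; linarith)
  have hmem : Icc (0 : ℝ) N ∈ 𝓝[Ici 0] t := by
    have : Ici (0 : ℝ) ∩ Iio (N : ℝ) ∈ 𝓝[Ici 0] t :=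
      inter_mem self_mem_nhdsWithin (mem_nhdsWithin_of_mem_nhds (Iio_mem_nhds htN))
    exact mem_of_superset this fun s hs => ⟨hs.1, le_of_lt hs.2⟩
  have hd := (hα N t ⟨ht, htN.le⟩).mono_of_mem_nhdsWithin hmem
  refine hd.congr_of_eventuallyEq ?_ rfl
  filter_upwards [hmem] with s hs
  exact agree' _ _ s hs.1 ((Nat.le_ceil s).trans (by push_cast; linarith)) hs.2

end GlobalExistence

/-! ### Lyapunov's indirect method -/

section Lyapunov

variable {X : Type*} [NormedAddCommGroup X] [NormedSpace ℝ X]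

/-- A vector field that is `C¹` at `p` agrees near `p` with a bounded Lipschitz one. -/
theorem exists_lipschitzWith_bounded_eqOn_closedBall [FiniteDimensional ℝ X] {f : X → X} {p : X}
    (hf : ContDiffAt ℝ 1 f p) :
    ∃ (h : X → X) (K L : NNReal) (r : ℝ), 0 < r ∧ LipschitzWith K h ∧ (∀ x, ‖h x‖ ≤ L) ∧
      ∀ x ∈ Metric.closedBall p r, h x = f x := by
  obtain ⟨R, hR, hRf⟩ := Metric.eventually_nhds_iff_ball.1 (hf.eventually (by simp))
  -- The cutoff is one on the ball of radius `R / 4`, and its support stays inside the ball where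
  -- `f` is `C¹`.
  let φ : ContDiffBump p := ⟨R / 4, R / 2, by linarith, by linarith⟩
  have hφ : tsupport (φ : X → ℝ) = Metric.closedBall p (R / 2) := φ.tsupport_eq
  have hcd : ContDiff ℝ 1 (fun x => φ x • f x) := by
    rw [contDiff_iff_contDiffAt]
    intro x
    by_cases hx : x ∈ Metric.ball p R
    · exact φ.contDiffAt.smul (hRf x hx)
    · have hx' : x ∉ tsupport (φ : X → ℝ) := by
        rw [hφ]
        intro h
        exact hx (Metric.closedBall_subset_ball (by linarith) h)
      have : (fun x => φ x • f x) =ᶠ[𝓝 x] fun _ => 0 := by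
        filter_upwards [notMem_tsupport_iff_eventuallyEq.1 hx'] with y hy
        simp [hy]
      exact contDiffAt_const.congr_of_eventuallyEq this
  have hcs : HasCompactSupport (fun x => φ x • f x) := φ.hasCompactSupport.smul_right
  obtain ⟨K, hK⟩ := hcd.lipschitzWith_of_hasCompactSupport hcs one_ne_zero
  obtain ⟨C, hC⟩ := hcs.exists_bound_of_continuous hcd.continuous
  refine ⟨_, K, C.toNNReal, R / 4, by linarith, hK, fun x => (hC x).trans (Real.le_coe_toNNReal C),
    fun x hx => ?_⟩
  simp [φ.one_of_mem_closedBall hx]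

/-- A quadratic form that is negative on nonzero vectors is bounded above by a negative multiple
of the squared norm. -/
theorem exists_neg_bound_of_quadratic [FiniteDimensional ℝ X] {q : X → ℝ} (hq : Continuous q)
    (hom : ∀ (c : ℝ) x, q (c • x) = c ^ 2 * q x) (hneg : ∀ x, x ≠ 0 → q x < 0) :
    ∃ c : ℝ, 0 < c ∧ ∀ x, q x ≤ -c * ‖x‖ ^ 2 := by
  have hcomp : IsCompact (Metric.sphere (0 : X) 1) := isCompact_sphere 0 1
  rcases (Metric.sphere (0 : X) 1).eq_empty_or_nonempty with he | hne
  · refine ⟨1, one_pos, fun x => ?_⟩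
    by_cases hx : x = 0
    · subst hx
      have := hom 0 (0 : X)
      simp at this
      simp [this]
    · exfalso
      have : ‖x‖⁻¹ • x ∈ Metric.sphere (0 : X) 1 := by
        simp [norm_smul, norm_ne_zero_iff.2 hx]
      simp [he] at this
  · obtain ⟨u, hu, hmax⟩ := hcomp.exists_isMaxOn hne hq.continuousOn
    have hu0 : u ≠ 0 := by
      rintro rfl
      simp at hu
    refine ⟨-q u, neg_pos.2 (hneg u hu0), fun x => ?_⟩
    by_cases hx : x = 0
    · subst hx
      have := hom 0 (0 : X)
      simp at this
      simp [this]
    · have hx' : ‖x‖ ≠ 0 := norm_ne_zero_iff.2 hx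
      have hmem : ‖x‖⁻¹ • x ∈ Metric.sphere (0 : X) 1 := by
        simp [norm_smul, hx']
      have h1 : q (‖x‖⁻¹ • x) ≤ q u := hmax hmem
      have h2 : q x = ‖x‖ ^ 2 * q (‖x‖⁻¹ • x) := by
        rw [← hom, smul_smul, mul_inv_cancel₀ hx', one_smul]
      rw [h2]
      nlinarith [sq_nonneg ‖x‖]

/-- If `V x = B (x - p) (x - p)` decreases along the field `h` inside a ball, at a rate at least
`μ V`, then `V` decays exponentially along forward solutions that start in a small sublevel set. -/
theorem lyapunov_exponential_decay {h : X → X} {p : X} {B : X →L[ℝ] X →L[ℝ] ℝ}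
    (hsymm : ∀ x y, B x y = B y x) {m μ ρ : ℝ} (hm : 0 < m) (hρ : 0 < ρ)
    (hpos : ∀ y, m * ‖y‖ ^ 2 ≤ B y y)
    (hdec : ∀ x ∈ Metric.closedBall p ρ, x ≠ p →
      2 * B (x - p) (h x) < -μ * B (x - p) (x - p)) (hμ : 0 < μ)
    {x : ℝ → X} (hx : IsForwardSolution h x) {β : ℝ} (hβ : 0 < β) (hβρ : β ≤ m * ρ ^ 2)
    (h0 : B (x 0 - p) (x 0 - p) ≤ β) {t : ℝ} (ht : 0 ≤ t) :
    B (x t - p) (x t - p) ≤ β * Real.exp (-μ * t) := by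
  have hderiv : ∀ s : ℝ, 0 ≤ s →
      HasDerivWithinAt (fun s => B (x s - p) (x s - p)) (2 * B (x s - p) (h (x s))) (Ici 0) s := by
    intro s hs
    have h1 : HasDerivWithinAt (fun s => x s - p) (h (x s)) (Ici 0) s := (hx s hs).sub_const p
    have h2 : HasDerivWithinAt (fun s => B (x s - p)) (B (h (x s))) (Ici 0) s :=
      B.hasFDerivAt.comp_hasDerivWithinAt s h1
    refine (h2.clm_apply h1).congr_deriv ?_
    rw [hsymm (h (x s))]
    ring
  have hB : ∀ s : ℝ, HasDerivAt (fun s => β * Real.exp (-μ * s))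
      (-μ * (β * Real.exp (-μ * s))) s := by
    intro s
    have := (((hasDerivAt_id s).const_mul (-μ)).exp).const_mul β
    refine this.congr_deriv ?_
    simp
    ring
  -- Comparison with `β exp(-μ s)`: the derivative inequality is needed only at contact times. There
  -- the value is at most `β ≤ m ρ²`, so `x s` is in the ball, and it is positive, so `x s ≠ p`. No
  -- prior trapping argument is needed.
  refine image_le_of_deriv_right_lt_deriv_boundary (a := 0) (b := t)
    (f := fun s => B (x s - p) (x s - p)) (f' := fun s => 2 * B (x s - p) (h (x s)))
    (fun s hs => ((hderiv s hs.1).continuousWithinAt).mono Icc_subset_Ici_self)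
    (fun s hs => (hderiv s hs.1).mono (Ici_subset_Ici.2 hs.1)) (by simpa using h0) hB ?_ ⟨ht, le_rfl⟩
  intro s hs heq
  have hpos' : 0 < β * Real.exp (-μ * s) := by positivity
  have hle : β * Real.exp (-μ * s) ≤ β := by
    have : Real.exp (-μ * s) ≤ 1 := Real.exp_le_one_iff.2 (by nlinarith [hs.1])
    nlinarith
  have hne : x s ≠ p := by
    intro h
    rw [h] at heq
    simp at heq
    linarith
  have hball : x s ∈ Metric.closedBall p ρ := by
    rw [mem_closedBall_iff_norm]
    have h1 := hpos (x s - p)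
    have h2 : m * ‖x s - p‖ ^ 2 ≤ m * ρ ^ 2 := by linarith
    exact le_of_sq_le_sq (le_of_mul_le_mul_left h2 hm) hρ.le
  have := hdec _ hball hne
  rw [heq] at this
  exact this

/-- **Lyapunov's indirect method**, with a quadratic Lyapunov function: an equilibrium of a `C¹`
vector field is locally asymptotically stable if some positive definite quadratic form strictly
decreases along the linearization. -/
theorem isLocallyAsymptoticallyStable_of_quadratic [FiniteDimensional ℝ X] {f : X → X} {p : X}
    (hf : ContDiffAt ℝ 1 f p) (hp : f p = 0) (B : X →L[ℝ] X →L[ℝ] ℝ)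
    (hsymm : ∀ x y, B x y = B y x) (hpos : ∀ y, y ≠ 0 → 0 < B y y)
    (hneg : ∀ y, y ≠ 0 → B y (fderiv ℝ f p y) < 0) :
    IsLocallyAsymptoticallyStable f p := by
  set A := fderiv ℝ f p with hA
  obtain ⟨m, hm, hmB⟩ : ∃ m : ℝ, 0 < m ∧ ∀ y, m * ‖y‖ ^ 2 ≤ B y y := by
    obtain ⟨m, hm, h⟩ := exists_neg_bound_of_quadratic (q := fun y => -(B y y)) (by fun_prop)
      (by intro c x; simp; ring) (fun y hy => by simpa using hpos y hy)
    exact ⟨m, hm, fun y => by have := h y; linarith⟩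
  obtain ⟨c, hc, hcB⟩ := exists_neg_bound_of_quadratic (q := fun y => B y (A y)) (by fun_prop)
      (by intro c x; simp; ring) hneg
  have hB0 : 0 < ‖B‖ + 1 := by positivity
  have hupper : ∀ y, B y y ≤ ‖B‖ * ‖y‖ ^ 2 := fun y => by
    calc B y y ≤ ‖B y y‖ := Real.le_norm_self _
      _ ≤ ‖B‖ * ‖y‖ * ‖y‖ := B.le_opNorm₂ y y
      _ = _ := by ring
  obtain ⟨h, K, L, r, hr, hK, hL, hhf⟩ := exists_lipschitzWith_bounded_eqOn_closedBall hf
  -- With this tolerance the nonlinear remainder costs at most half of the decay rate `c` of the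
  -- linear part.
  have hη : 0 < c / (2 * (‖B‖ + 1)) := by positivity
  have hlin := (hf.differentiableAt one_ne_zero).hasFDerivAt.isLittleO.bound hη
  obtain ⟨r', hr', hlin'⟩ := Metric.eventually_nhds_iff_ball.1 hlin
  obtain ⟨ρ, hρ, hρr, hρr'⟩ : ∃ ρ : ℝ, 0 < ρ ∧ ρ ≤ r ∧ ρ < r' :=
    ⟨min r (r' / 2), by positivity, min_le_left _ _, (min_le_right _ _).trans_lt (by linarith)⟩
  obtain ⟨μ, hμ, hμc⟩ : ∃ μ : ℝ, 0 < μ ∧ μ * ‖B‖ < c := by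
    refine ⟨c / (‖B‖ + 1), by positivity, ?_⟩
    rw [div_mul_eq_mul_div, div_lt_iff₀ hB0]
    nlinarith
  have hdec : ∀ x ∈ Metric.closedBall p ρ, x ≠ p →
      2 * B (x - p) (f x) < -μ * B (x - p) (x - p) := by
    intro x hx hxp
    have hnorm : 0 < ‖x - p‖ := norm_pos_iff.2 (sub_ne_zero.2 hxp)
    have h1 := hlin' x (Metric.closedBall_subset_ball hρr' hx)
    rw [hp, sub_zero] at h1
    have h2 : B (x - p) (f x) = B (x - p) (A (x - p)) + B (x - p) (f x - A (x - p)) := by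
      rw [map_sub (B (x - p))]
      ring
    have h3 : B (x - p) (f x - A (x - p)) ≤ c / 2 * ‖x - p‖ ^ 2 := by
      calc B (x - p) (f x - A (x - p)) ≤ ‖B (x - p) (f x - A (x - p))‖ := Real.le_norm_self _
        _ ≤ ‖B‖ * ‖x - p‖ * ‖f x - A (x - p)‖ := B.le_opNorm₂ _ _
        _ ≤ (‖B‖ + 1) * ‖x - p‖ * (c / (2 * (‖B‖ + 1)) * ‖x - p‖) := by
          gcongr
          linarith
        _ = c / 2 * ‖x - p‖ ^ 2 := by field_simp
    have h4 := hcB (x - p)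
    have h5 := hupper (x - p)
    have h6 : μ * B (x - p) (x - p) ≤ μ * (‖B‖ * ‖x - p‖ ^ 2) := by gcongr
    have h7 : μ * ‖B‖ * ‖x - p‖ ^ 2 < c * ‖x - p‖ ^ 2 := by gcongr
    nlinarith
  have hdech : ∀ x ∈ Metric.closedBall p ρ, x ≠ p →
      2 * B (x - p) (h x) < -μ * B (x - p) (x - p) := by
    intro x hx hxp
    rw [hhf x (Metric.closedBall_subset_closedBall hρr hx)]
    exact hdec x hx hxp
  have hstart : ∀ β : ℝ, 0 < β → ∃ δ : ℝ, 0 < δ ∧ ∀ x, dist x p < δ → B (x - p) (x - p) ≤ β := by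
    intro β hβ
    refine ⟨√(β / (‖B‖ + 1)), by positivity, fun x hx => ?_⟩
    rw [dist_eq_norm, Real.lt_sqrt (norm_nonneg _), lt_div_iff₀ hB0] at hx
    nlinarith [hupper (x - p), sq_nonneg ‖x - p‖]
  have htrap : ∀ ρ' : ℝ, 0 < ρ' → ∀ (x : X) (s : ℝ), s ≤ 1 → 0 ≤ s →
      B (x - p) (x - p) ≤ m * ρ' ^ 2 * s → dist x p ≤ ρ' := by
    intro ρ' hρ' x s hs hs0 hx
    rw [dist_eq_norm]
    refine le_of_sq_le_sq (le_of_mul_le_mul_left ((hmB (x - p)).trans ?_) hm) hρ'.le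
    have : 0 < m * ρ' ^ 2 := by positivity
    nlinarith
  have hexp : ∀ t : ℝ, 0 ≤ t → Real.exp (-μ * t) ≤ 1 := fun t ht =>
    Real.exp_le_one_iff.2 (by nlinarith)
  refine ⟨hp, ?_, ?_⟩
  · intro ε hε
    obtain ⟨ρ', hρ', hρ'ρ, hρ'ε⟩ : ∃ ρ' : ℝ, 0 < ρ' ∧ ρ' ≤ ρ ∧ ρ' < ε :=
      ⟨min ρ (ε / 2), by positivity, min_le_left _ _, (min_le_right _ _).trans_lt (by linarith)⟩
    have hβ : 0 < m * ρ' ^ 2 := by positivity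
    have hβρ : m * ρ' ^ 2 ≤ m * ρ ^ 2 := by gcongr
    obtain ⟨δ, hδ, hδβ⟩ := hstart _ hβ
    refine ⟨δ, hδ, fun x₀ hx₀ => ⟨?_, ?_⟩⟩
    · obtain ⟨x, hx0, hx⟩ := exists_isForwardSolution_of_lipschitzWith_of_bounded hK hL x₀
      refine ⟨x, hx0, fun t ht => ?_⟩
      -- The solution of the cut-off field never leaves the ball where that field equals `f`, so it
      -- solves the original equation.
      have h1 := lyapunov_exponential_decay hsymm hm hρ hmB hdech hμ hx hβ hβρ
        (by rw [hx0]; exact hδβ _ hx₀) ht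
      have h2 := htrap ρ' hρ' _ _ (hexp t ht) (Real.exp_pos _).le h1
      rw [← hhf (x t) (Metric.mem_closedBall.2 (h2.trans (hρ'ρ.trans hρr)))]
      exact hx t ht
    · intro x hx0 hx t ht
      have h1 := lyapunov_exponential_decay hsymm hm hρ hmB hdec hμ hx hβ hβρ
        (by rw [hx0]; exact hδβ _ hx₀) ht
      exact (htrap ρ' hρ' _ _ (hexp t ht) (Real.exp_pos _).le h1).trans_lt hρ'ε
  · have hβ : 0 < m * ρ ^ 2 := by positivity
    obtain ⟨δ, hδ, hδβ⟩ := hstart _ hβ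
    refine ⟨δ, hδ, fun x hx0 hx => ?_⟩
    have h1 : ∀ t : ℝ, 0 ≤ t → ‖x t - p‖ ^ 2 ≤ ρ ^ 2 * Real.exp (-μ * t) := by
      intro t ht
      have h1 := lyapunov_exponential_decay hsymm hm hρ hmB hdec hμ hx hβ le_rfl
        (hδβ _ hx0) ht
      have h2 := hmB (x t - p)
      refine le_of_mul_le_mul_left (h2.trans (h1.trans_eq ?_)) hm
      ring
    have h2 : Tendsto (fun t : ℝ => ρ ^ 2 * Real.exp (-μ * t)) atTop (𝓝 0) := by
      have h3 : Tendsto (fun t : ℝ => μ * t) atTop atTop := tendsto_id.const_mul_atTop hμ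
      have h4 := (Real.tendsto_exp_neg_atTop_nhds_zero.comp h3).const_mul (ρ ^ 2)
      simpa [Function.comp_def] using h4
    have h3 : Tendsto (fun t : ℝ => ‖x t - p‖ ^ 2) atTop (𝓝 0) :=
      squeeze_zero' (Eventually.of_forall fun t => sq_nonneg _)
        ((eventually_ge_atTop 0).mono h1) h2
    have h4 : Tendsto (fun t : ℝ => ‖x t - p‖) atTop (𝓝 0) := by
      have := h3.sqrt
      simpa using this
    exact tendsto_iff_norm_sub_tendsto_zero.2 h4

end Lyapunov

/-! ### Lyapunov form for the aggregate dynamics -/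

section Aggregate

/-- Positivity of the Lyapunov form of the fast subsystem. -/
theorem fast_lyapunov_pos {K γ ε α : ℝ} (hγ0 : 0 < γ) (hK : 0 < K) (hε : 0 < ε)
    (h3 : ε * 16 ≤ K) (h4 : ε * 64 ≤ γ) (h5 : ε ≤ 1) (a4 : α ≤ K / 4) (a5 : α ≤ γ / 4)
    (a6 : α ≤ 1 / 2) (G z η : ℝ) :
    α * (G ^ 2 + z ^ 2 + η ^ 2) ≤
      K * G ^ 2 + γ * z ^ 2 + η ^ 2 + 2 * ε * (G - 2 * z) * η := by
  -- Half of this square absorbs the cross term, at a cost `2 ε² (G - 2z)²` that small `ε` pays from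
  -- the `G` and `z` terms.
  have e1 : 0 ≤ (η + 2 * ε * (G - 2 * z)) ^ 2 := sq_nonneg _
  have e2 : (G - 2 * z) ^ 2 ≤ 2 * G ^ 2 + 8 * z ^ 2 := by linarith [sq_nonneg (G + 2 * z)]
  have e3 : ε ^ 2 ≤ ε := by nlinarith
  have e4 : ε ^ 2 * (G - 2 * z) ^ 2 ≤ ε * (2 * G ^ 2 + 8 * z ^ 2) := by gcongr
  have e5 : α * G ^ 2 ≤ K / 4 * G ^ 2 := by gcongr
  have e6 : α * z ^ 2 ≤ γ / 4 * z ^ 2 := by gcongr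
  have e7 : α * η ^ 2 ≤ 1 / 2 * η ^ 2 := by gcongr
  have e8 : ε * 16 * G ^ 2 ≤ K * G ^ 2 := by gcongr
  have e9 : ε * 64 * z ^ 2 ≤ γ * z ^ 2 := by gcongr
  have e10 := mul_nonneg hγ0.le (sq_nonneg z)
  have e11 := mul_nonneg hK.le (sq_nonneg G)
  linarith

/-- Decay of the Lyapunov form of the fast subsystem, for a small cross coefficient `ε`. -/
theorem fast_lyapunov_decay {w b K d σ γ ε α : ℝ} (hw : 0 < w)
    (hK : 0 < K) (hd : 0 ≤ d) (hσ : 0 ≤ σ) (hdσ : d + σ ≤ w) (hγ0 : 0 < γ) (hγw : γ * w = K * b)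
    (hε : 0 < ε) (h1 : ε * ((d + b + 2 * σ) ^ 2 + K) ≤ K * b / 4) (h2 : ε * (8 * w ^ 2) ≤ K * b)
    (a1 : α ≤ K * b / 4) (a2 : α ≤ ε * K) (a3 : α ≤ ε / 2) (G z η : ℝ) :
    K * G * (-(d + b) * G - η + b * z) + γ * z * (-w * z + σ * G) + η * (K * G) +
        ε * (((-(d + b) * G - η + b * z) - 2 * (-w * z + σ * G)) * η + (G - 2 * z) * (K * G)) ≤
      -α * ((G - z) ^ 2 + z ^ 2 + η ^ 2) := by
  obtain ⟨h, hh⟩ : ∃ h, h = d + b + 2 * σ := ⟨_, rfl⟩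
  rw [← hh] at h1
  -- `e` is the flexible conductance. If `τ = w - σ` vanishes, the diagonal part of the form damps
  -- only `e`; damping of `z` and `η` must then come from the cross term.
  obtain ⟨e, rfl⟩ : ∃ e, G = e + z := ⟨G - z, by ring⟩
  obtain ⟨τ, hτ⟩ : ∃ τ, τ = w - σ := ⟨_, rfl⟩
  have hτ0 : 0 ≤ τ := by linarith
  have hτw : τ ≤ w := by linarith
  have hγσ : γ * σ = K * b - γ * τ := by rw [hτ]; linear_combination hγw
  have id1 : K * (e + z) * (-(d + b) * (e + z) - η + b * z) +
      γ * z * (-w * z + σ * (e + z)) + η * (K * (e + z)) =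
      -(K * d * (e + z) ^ 2) - K * b * e ^ 2 - γ * τ * (z ^ 2 + e * z) := by
    linear_combination (-z ^ 2) * hγw + (z * (e + z)) * hγσ
  -- The factor 2 in `G - 2z` makes the last product `K (e² - z²)`, which damps `z`; the term `-η²`
  -- comes from `G' = -η + …`.
  have id2 : ((-(d + b) * (e + z) - η + b * z) - 2 * (-w * z + σ * (e + z))) * η +
      ((e + z) - 2 * z) * (K * (e + z)) =
      -η ^ 2 + (2 * τ - d) * z * η - h * e * η + K * e ^ 2 - K * z ^ 2 := by
    rw [hτ, hh]; ring
  have hγτ : 0 ≤ γ * τ := by positivity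
  have hγτ' : γ * τ ≤ K * b := hγw ▸ by gcongr
  have t1 : -(γ * τ * (z ^ 2 + e * z)) ≤ -(γ * τ / 2 * z ^ 2) + K * b / 2 * e ^ 2 := by
    have := mul_nonneg hγτ (sq_nonneg (e + z))
    have : γ * τ * e ^ 2 ≤ K * b * e ^ 2 := by gcongr
    linarith
  -- Since `d ≤ τ`, the squared coefficient of `z η` is of order `τ`, so `γ τ z²` can absorb it
  -- however small `τ` is.
  have t2 : (2 * τ - d) * z * η ≤ η ^ 2 / 4 + 4 * w * τ * z ^ 2 := by
    have q1 : 0 ≤ (η / 2 - (2 * τ - d) * z) ^ 2 := sq_nonneg _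
    have q2 : (2 * τ - d) ^ 2 ≤ 4 * w * τ := by
      have : d ≤ τ := by linarith
      have q3 : (2 * τ - d) ^ 2 ≤ (2 * τ) ^ 2 :=
        pow_le_pow_left₀ (by linarith) (by linarith) 2
      have q4 : τ * τ ≤ w * τ := by gcongr
      linarith
    have q3 : (2 * τ - d) ^ 2 * z ^ 2 ≤ 4 * w * τ * z ^ 2 := by gcongr
    linarith
  have t3 : -(h * e * η) ≤ η ^ 2 / 4 + h ^ 2 * e ^ 2 := by
    linarith [sq_nonneg (η / 2 + h * e)]
  have t4 : 0 ≤ K * d * (e + z) ^ 2 := by positivity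
  have t5 : ε * (-η ^ 2 + (2 * τ - d) * z * η - h * e * η + K * e ^ 2 - K * z ^ 2) ≤
      ε * (-(η ^ 2 / 2) + 4 * w * τ * z ^ 2 + (h ^ 2 + K) * e ^ 2 - K * z ^ 2) := by
    refine mul_le_mul_of_nonneg_left ?_ hε.le
    linarith
  have t6 : ε * (h ^ 2 + K) * e ^ 2 ≤ K * b / 4 * e ^ 2 := by gcongr
  have t7 : ε * (4 * w * τ) ≤ γ * τ / 2 := by
    have : ε * (8 * w) ≤ γ := by
      refine le_of_mul_le_mul_right ?_ hw
      rw [hγw]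
      linarith
    nlinarith
  have t8 : ε * (4 * w * τ) * z ^ 2 ≤ γ * τ / 2 * z ^ 2 := by gcongr
  have t9 : α * e ^ 2 ≤ K * b / 4 * e ^ 2 := by gcongr
  have t10 : α * z ^ 2 ≤ ε * K * z ^ 2 := by gcongr
  have t11 : α * η ^ 2 ≤ ε / 2 * η ^ 2 := by gcongr
  rw [id1, id2]
  have t12 : (e + z - z) ^ 2 = e ^ 2 := by ring
  rw [t12]
  linarith

/-- The fast subsystem (frozen filter states): a quadratic form in the total conductance `G`, the
inflexible conductance `z` and the shifted shared state `η` that decays strictly. -/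
theorem fast_subsystem_lyapunov {w b K d σ : ℝ} (hw : 0 < w) (hb : 0 < b) (hK : 0 < K)
    (hd : 0 ≤ d) (hσ : 0 ≤ σ) (hdσ : d + σ ≤ w) :
    ∃ ε α : ℝ, 0 < ε ∧ 0 < α ∧
      (∀ G z η : ℝ, α * (G ^ 2 + z ^ 2 + η ^ 2) ≤
        K * G ^ 2 + K * b / w * z ^ 2 + η ^ 2 + 2 * ε * (G - 2 * z) * η) ∧
      (∀ G z η : ℝ,
        K * G * (-(d + b) * G - η + b * z) + K * b / w * z * (-w * z + σ * G) + η * (K * G) +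
          ε * (((-(d + b) * G - η + b * z) - 2 * (-w * z + σ * G)) * η + (G - 2 * z) * (K * G)) ≤
        -α * ((G - z) ^ 2 + z ^ 2 + η ^ 2)) := by
  obtain ⟨γ, hγ⟩ : ∃ γ, γ = K * b / w := ⟨_, rfl⟩
  have hγ0 : 0 < γ := hγ ▸ by positivity
  have hγw : γ * w = K * b := by rw [hγ]; field_simp
  have hh0 : 0 < (d + b + 2 * σ) ^ 2 + K := by positivity
  obtain ⟨ε, hε, h1, h2, h3, h4, h5⟩ : ∃ ε : ℝ, 0 < ε ∧ ε * ((d + b + 2 * σ) ^ 2 + K) ≤ K * b / 4 ∧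
      ε * (8 * w ^ 2) ≤ K * b ∧ ε * 16 ≤ K ∧ ε * 64 ≤ γ ∧ ε ≤ 1 := by
    refine ⟨min (K * b / 4 / ((d + b + 2 * σ) ^ 2 + K)) (min (K * b / (8 * w ^ 2)) (min (K / 16)
      (min (γ / 64) 1))), by positivity, ?_, ?_, ?_, ?_, ?_⟩
    · rw [← le_div_iff₀ hh0]; exact min_le_left _ _
    · rw [← le_div_iff₀ (by positivity)]
      exact (min_le_right _ _).trans (min_le_left _ _)
    · rw [← le_div_iff₀ (by positivity)]
      exact (min_le_right _ _).trans ((min_le_right _ _).trans (min_le_left _ _))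
    · rw [← le_div_iff₀ (by positivity)]
      exact (min_le_right _ _).trans ((min_le_right _ _).trans ((min_le_right _ _).trans
        (min_le_left _ _)))
    · exact (min_le_right _ _).trans ((min_le_right _ _).trans ((min_le_right _ _).trans
        (min_le_right _ _)))
  obtain ⟨α, hα, a1, a2, a3, a4, a5, a6⟩ : ∃ α : ℝ, 0 < α ∧ α ≤ K * b / 4 ∧ α ≤ ε * K ∧
      α ≤ ε / 2 ∧ α ≤ K / 4 ∧ α ≤ γ / 4 ∧ α ≤ 1 / 2 := by
    refine ⟨min (K * b / 4) (min (ε * K) (min (ε / 2) (min (K / 4) (min (γ / 4) (1 / 2))))),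
      by positivity, ?_, ?_, ?_, ?_, ?_, ?_⟩ <;> simp
  rw [← hγ]
  exact ⟨ε, α, hε, hα, fast_lyapunov_pos hγ0 hK hε h3 h4 h5 a4 a5 a6,
    fast_lyapunov_decay hw hK hd hσ hdσ hγ0 hγw hε h1 h2 a1 a2 a3⟩

/-- With slow filters, the aggregate linearization in `(G, z, η, U)` has the fast Lyapunov form
plus `U ^ 2` as a Lyapunov form. -/
theorem aggregate_lyapunov {w b K d σ : ℝ} (hw : 0 < w) (hb : 0 < b) (hK : 0 < K)
    (hd : 0 ≤ d) (hσ : 0 ≤ σ) (hdσ : d + σ ≤ w) :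
    ∃ ε a₀ : ℝ, 0 < a₀ ∧
      (∀ G z η : ℝ, 0 ≤ K * G ^ 2 + K * b / w * z ^ 2 + η ^ 2 + 2 * ε * (G - 2 * z) * η) ∧
      (∀ G z η : ℝ, K * G ^ 2 + K * b / w * z ^ 2 + η ^ 2 + 2 * ε * (G - 2 * z) * η ≤ 0 →
        η = 0) ∧
      ∀ a : ℝ, 0 < a → a < a₀ → ∃ c : ℝ, 0 < c ∧ ∀ G z η U : ℝ,
        K * G * (-(d + b) * G - η + b * z) + K * b / w * z * (-w * z + σ * G) +
          η * (K * G + a * b * (U - G + z)) +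
          ε * (((-(d + b) * G - η + b * z) - 2 * (-w * z + σ * G)) * η +
            (G - 2 * z) * (K * G + a * b * (U - G + z))) + U * (a * (G - z - U)) ≤
        -c * (G ^ 2 + η ^ 2 + U ^ 2) := by
  obtain ⟨ε, α, hε, hα, hpos, hdec⟩ := fast_subsystem_lyapunov hw hb hK hd hσ hdσ
  -- `C` collects the constants of the Young inequalities below; `a < α / (2 * C)` keeps the
  -- coupling cost `a C N` under half of the fast decay `α N`.
  obtain ⟨C, hC⟩ : ∃ C, C = 9 / 2 * b ^ 2 * (1 + ε ^ 2) + 3 / 2 := ⟨_, rfl⟩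
  have hC0 : 0 < C := hC ▸ by positivity
  refine ⟨ε, α / (2 * C), by positivity, fun G z η => le_trans (by positivity) (hpos G z η),
    fun G z η h => ?_, fun a ha ha' => ?_⟩
  · have := hpos G z η
    by_contra hη
    have h1 : 0 < α * (G ^ 2 + z ^ 2 + η ^ 2) := by positivity
    linarith
  · have haC : a * (2 * C) < α := (lt_div_iff₀ (by positivity)).1 ha'
    refine ⟨min (α / 4) (a / 2), by positivity, fun G z η U => ?_⟩
    have h0 := hdec G z η
    obtain ⟨e, rfl⟩ : ∃ e, G = e + z := ⟨G - z, by ring⟩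
    obtain ⟨N, hN⟩ : ∃ N, N = e ^ 2 + z ^ 2 + η ^ 2 := ⟨_, rfl⟩
    have hN0 : 0 ≤ N := hN ▸ by positivity
    -- `Y = η + ε (G - 2z)` is the factor multiplying `η'` in the derivative of the form, hence the
    -- one that meets the `O(a)` perturbation.
    obtain ⟨Y, hY⟩ : ∃ Y, Y = η + ε * (e - z) := ⟨_, rfl⟩
    have hY2 : Y ^ 2 ≤ 3 * (1 + ε ^ 2) * N := by
      have : Y ^ 2 ≤ 3 * (η ^ 2 + (ε * e) ^ 2 + (ε * z) ^ 2) := by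
        rw [hY]
        linarith [sq_nonneg (η - ε * e), sq_nonneg (η + ε * z), sq_nonneg (ε * e + ε * z)]
      have : 0 ≤ ε ^ 2 * η ^ 2 := by positivity
      rw [hN]
      linarith [sq_nonneg e, sq_nonneg z]
    have h1 : b * Y * (U - e) + U * e - U ^ 2 ≤ -(U ^ 2 / 2) + C * N := by
      have q1 : b * Y * U ≤ U ^ 2 / 4 + b ^ 2 * Y ^ 2 := by linarith [sq_nonneg (U / 2 - b * Y)]
      have q2 : -(b * Y * e) ≤ b ^ 2 * Y ^ 2 / 2 + e ^ 2 / 2 := by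
        linarith [sq_nonneg (b * Y + e)]
      have q3 : U * e ≤ U ^ 2 / 4 + e ^ 2 := by linarith [sq_nonneg (U / 2 - e)]
      have q4 : b ^ 2 * Y ^ 2 ≤ b ^ 2 * (3 * (1 + ε ^ 2) * N) := by gcongr
      have q5 : e ^ 2 ≤ N := by rw [hN]; linarith [sq_nonneg z, sq_nonneg η]
      rw [hC]
      linarith
    have h2 : a * (b * Y * (U - e) + U * e - U ^ 2) ≤ a * (-(U ^ 2 / 2) + C * N) := by gcongr
    have h3 : a * (2 * C) * N ≤ α * N := by gcongr
    have h4 : min (α / 4) (a / 2) * ((e + z) ^ 2 + η ^ 2 + U ^ 2) ≤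
        α / 4 * (2 * N) + a / 2 * U ^ 2 := by
      have r1 : (e + z) ^ 2 + η ^ 2 ≤ 2 * N := by
        rw [hN]; linarith [sq_nonneg (e - z), sq_nonneg η]
      have r2 : min (α / 4) (a / 2) * (2 * N) ≤ α / 4 * (2 * N) := by gcongr; exact min_le_left _ _
      have r3 : min (α / 4) (a / 2) * U ^ 2 ≤ a / 2 * U ^ 2 := by gcongr; exact min_le_right _ _
      have r4 : 0 < min (α / 4) (a / 2) := by positivity
      nlinarith
    have h5 : (e + z - z) ^ 2 + z ^ 2 + η ^ 2 = N := by rw [hN]; ring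
    rw [h5] at h0
    have h6 : η * (a * b * (U - (e + z) + z)) + ε * ((e + z - 2 * z) * (a * b * (U - (e + z) + z))) +
        U * (a * (e + z - z - U)) = a * (b * Y * (U - e) + U * e - U ^ 2) := by
      rw [hY]; ring
    linarith

end Aggregate

open StarNetwork

/-! ### Aggregate coordinates of the filters and the shared state -/

section FilterStates

variable {F I : Type*} [Fintype F]

/-- Sum of the auxiliary states. -/
def filterSum (y : State F I) : ℝ := ∑ i, y.2.2 i

/-- Shared state relative to its quasi-steady value. -/
def shiftedShared (κb b : ℝ) (y : State F I) : ℝ := κb * y.2.1 - b * filterSum y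

/-- A state with vanishing loads, auxiliary states and relative shared state is zero. -/
theorem state_eq_zero {κb b : ℝ} (hκb : κb ≠ 0) {y : State F I}
    (hF : ∀ i, y.1 (Sum.inl i) = 0) (hI : ∀ j, y.1 (Sum.inr j) = 0) (hh : ∀ i, y.2.2 i = 0)
    (hη : shiftedShared κb b y = 0) : y = 0 := by
  have hφ : y.2.1 = 0 := by
    simpa [shiftedShared, filterSum, hh, hκb] using hη
  refine Prod.ext (funext fun i => ?_) (Prod.ext hφ (funext hh))
  cases i with
  | inl i => exact hF i
  | inr j => exact hI j

end FilterStates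

/-! ### From the aggregates to the full linearization -/

section Cascade

variable {F I : Type*} [Fintype F] [Fintype I]

/-- The linearization of the closed loop at an equilibrium, in terms of the squared voltage `w`, the
sensitivities `s` of the powers to the total conductance, and the gain `k` of the shared state. -/
def linearizedField (w b k : ℝ) (κ : F → ℝ) (s : F ⊕ I → ℝ) (a : ℝ) : State F I → State F I :=
  fun y =>
    (Sum.elim
      (fun i => -(w * y.1 (Sum.inl i) - s (Sum.inl i) * totalConductance y.1) - κ i * y.2.1 +
        b * (y.2.2 i - y.1 (Sum.inl i)))
      (fun j => -(w * y.1 (Sum.inr j) - s (Sum.inr j) * totalConductance y.1)),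
     k * totalConductance y.1,
     fun i => -a * (y.2.2 i - y.1 (Sum.inl i)))

/-- The Lyapunov form: a multiple `Λ` of the form of the aggregate dynamics, plus diagonal terms
for the individual loads. -/
def cascadeForm (Λ K γ ε a b κb : ℝ) : State F I →L[ℝ] State F I →L[ℝ] ℝ :=
  let g : F ⊕ I → State F I →L[ℝ] ℝ := fun i =>
    (ContinuousLinearMap.proj (R := ℝ) (φ := fun _ : F ⊕ I => ℝ) i).comp
      (ContinuousLinearMap.fst ℝ _ _)
  let φ : State F I →L[ℝ] ℝ :=
    (ContinuousLinearMap.fst ℝ _ _).comp (ContinuousLinearMap.snd ℝ _ _)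
  let h : F → State F I →L[ℝ] ℝ := fun i =>
    (ContinuousLinearMap.proj (R := ℝ) (φ := fun _ : F => ℝ) i).comp
      ((ContinuousLinearMap.snd ℝ _ _).comp (ContinuousLinearMap.snd ℝ _ _))
  let G := ∑ i, g i
  let z := ∑ j, g (Sum.inr j)
  let U := ∑ i, h i
  let η := κb • φ - b • U
  let ξ := G - (2 : ℝ) • z
  Λ • (K • G.smulRight G + γ • z.smulRight z + η.smulRight η +
    ε • (ξ.smulRight η + η.smulRight ξ) + U.smulRight U) +
  -- With weights `a` and `b`, the exchange between a load and its filter contributes exactly `-a b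
  -- (g i - ĝ i)²`.
  (∑ i, (a • (g (Sum.inl i)).smulRight (g (Sum.inl i)) + b • (h i).smulRight (h i)) +
    ∑ j, (g (Sum.inr j)).smulRight (g (Sum.inr j)))

/-- Total conductance of the inflexible loads. -/
def inflexibleConductance (y : State F I) : ℝ := ∑ j, y.1 (Sum.inr j)

theorem cascadeForm_apply (Λ K γ ε a b κb : ℝ) (y x : State F I) :
    cascadeForm Λ K γ ε a b κb y x =
      Λ * (K * totalConductance y.1 * totalConductance x.1 +
        γ * inflexibleConductance y * inflexibleConductance x +
        shiftedShared κb b y * shiftedShared κb b x +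
        ε * ((totalConductance y.1 - 2 * inflexibleConductance y) * shiftedShared κb b x +
          shiftedShared κb b y * (totalConductance x.1 - 2 * inflexibleConductance x)) +
        filterSum y * filterSum x) +
      (∑ i, (a * y.1 (Sum.inl i) * x.1 (Sum.inl i) + b * y.2.2 i * x.2.2 i) +
        ∑ j, y.1 (Sum.inr j) * x.1 (Sum.inr j)) := by
  simp only [cascadeForm, totalConductance, inflexibleConductance, filterSum, shiftedShared,
    add_apply, sub_apply, smul_apply,
    ContinuousLinearMap.smulRight_apply, sum_apply,
    ContinuousLinearMap.comp_apply, ContinuousLinearMap.proj_apply,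
    ContinuousLinearMap.coe_fst', ContinuousLinearMap.coe_snd', smul_eq_mul, mul_assoc]

theorem cascadeForm_symm (Λ K γ ε a b κb : ℝ) (y x : State F I) :
    cascadeForm Λ K γ ε a b κb y x = cascadeForm Λ K γ ε a b κb x y := by
  simp only [cascadeForm_apply]
  congr 1
  · ring
  · congr 1 <;> refine Finset.sum_congr rfl fun i _ => by ring

/-- Passing to `η = κ̄ φ - b U` absorbs the filter input, so `G'` involves only `G`, `η` and `z`. -/
theorem linearizedField_totalConductance (w b k : ℝ) (κ : F → ℝ) (s : F ⊕ I → ℝ) (a : ℝ)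
    (y : State F I) :
    totalConductance (linearizedField w b k κ s a y).1 =
      -((w - ∑ i, s i) + b) * totalConductance y.1 - shiftedShared (∑ i, κ i) b y +
        b * inflexibleConductance y := by
  have hG : totalConductance y.1 = ∑ i, y.1 (Sum.inl i) + ∑ j, y.1 (Sum.inr j) :=
    Fintype.sum_sum_type _
  have : totalConductance (linearizedField w b k κ s a y).1 =
      (-(w * ∑ i, y.1 (Sum.inl i) - (∑ i, s (Sum.inl i)) * totalConductance y.1) -
        (∑ i, κ i) * y.2.1 + b * (∑ i, y.2.2 i - ∑ i, y.1 (Sum.inl i))) +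
      -(w * ∑ j, y.1 (Sum.inr j) - (∑ j, s (Sum.inr j)) * totalConductance y.1) := by
    simp only [Finset.mul_sum, Finset.sum_mul, ← Finset.sum_sub_distrib, ← Finset.sum_add_distrib,
      ← Finset.sum_neg_distrib]
    exact Fintype.sum_sum_type _
  rw [this, Fintype.sum_sum_type s, shiftedShared, filterSum, inflexibleConductance]
  linear_combination (b + w) * hG

theorem linearizedField_inflexibleConductance (w b k : ℝ) (κ : F → ℝ) (s : F ⊕ I → ℝ) (a : ℝ)
    (y : State F I) :
    inflexibleConductance (linearizedField w b k κ s a y) =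
      -w * inflexibleConductance y + (∑ j, s (Sum.inr j)) * totalConductance y.1 := by
  simp only [inflexibleConductance, Finset.mul_sum, Finset.sum_mul, ← Finset.sum_add_distrib]
  refine Finset.sum_congr rfl fun j _ => ?_
  simp only [linearizedField, Sum.elim_inr]
  ring

theorem linearizedField_filterSum (w b k : ℝ) (κ : F → ℝ) (s : F ⊕ I → ℝ) (a : ℝ)
    (y : State F I) :
    filterSum (linearizedField w b k κ s a y) =
      a * (totalConductance y.1 - inflexibleConductance y - filterSum y) := by
  have hG : totalConductance y.1 = ∑ i, y.1 (Sum.inl i) + ∑ j, y.1 (Sum.inr j) :=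
    Fintype.sum_sum_type _
  simp only [filterSum, linearizedField, inflexibleConductance, ← Finset.mul_sum,
    Finset.sum_sub_distrib, hG]
  ring

/-- `U` enters only with the factor `a`: slow filters leave `(G, z, η)` nearly autonomous. -/
theorem linearizedField_shiftedShared (w b k κb : ℝ) (κ : F → ℝ) (s : F ⊕ I → ℝ) (a : ℝ)
    (y : State F I) :
    shiftedShared κb b (linearizedField w b k κ s a y) =
      κb * k * totalConductance y.1 +
        a * b * (filterSum y - totalConductance y.1 + inflexibleConductance y) := by
  rw [shiftedShared, linearizedField_filterSum]
  simp only [linearizedField]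
  ring

/-- Energy balance of the individual loads, driven by the aggregate states. -/
theorem individual_decay {w b k : ℝ} (hw : 0 < w) (κ : F → ℝ) (hκ : 0 < ∑ i, κ i)
    (s : F ⊕ I → ℝ) {a : ℝ} (ha : 0 < a) :
    ∃ D : ℝ, 0 ≤ D ∧ ∀ y : State F I,
      (∑ i, (a * y.1 (Sum.inl i) * (linearizedField w b k κ s a y).1 (Sum.inl i) +
          b * y.2.2 i * (linearizedField w b k κ s a y).2.2 i) +
        ∑ j, y.1 (Sum.inr j) * (linearizedField w b k κ s a y).1 (Sum.inr j)) ≤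
      D * (totalConductance y.1 ^ 2 + shiftedShared (∑ i, κ i) b y ^ 2 + filterSum y ^ 2) -
        (∑ i, (a * w / 2 * y.1 (Sum.inl i) ^ 2 + a * b * (y.1 (Sum.inl i) - y.2.2 i) ^ 2) +
          ∑ j, w / 2 * y.1 (Sum.inr j) ^ 2) := by
  obtain ⟨c₁, hc₁⟩ : ∃ c, c = a / w * ∑ i, s (Sum.inl i) ^ 2 +
    1 / (2 * w) * ∑ j, s (Sum.inr j) ^ 2 := ⟨_, rfl⟩
  obtain ⟨c₂, hc₂⟩ : ∃ c, c = a / w * ∑ i, κ i ^ 2 := ⟨_, rfl⟩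
  obtain ⟨κb, hκb⟩ : ∃ c, c = ∑ i, κ i := ⟨_, rfl⟩
  rw [← hκb] at hκ ⊢
  have hc₁0 : 0 ≤ c₁ := by
    rw [hc₁]
    exact add_nonneg (mul_nonneg (by positivity) (Finset.sum_nonneg fun _ _ => sq_nonneg _))
      (mul_nonneg (by positivity) (Finset.sum_nonneg fun _ _ => sq_nonneg _))
  have hc₂0 : 0 ≤ c₂ := by
    rw [hc₂]
    exact mul_nonneg (by positivity) (Finset.sum_nonneg fun _ _ => sq_nonneg _)
  refine ⟨c₁ + c₂ * (2 * (1 + b ^ 2) / κb ^ 2), by positivity, fun y => ?_⟩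
  obtain ⟨G, hG⟩ : ∃ G, G = totalConductance y.1 := ⟨_, rfl⟩
  -- The shared state is recovered from the aggregates through `κ̄ φ = η + b U`.
  have hφ : y.2.1 ^ 2 ≤ 2 * (1 + b ^ 2) / κb ^ 2 *
      (shiftedShared κb b y ^ 2 + filterSum y ^ 2) := by
    rw [div_mul_eq_mul_div, le_div_iff₀ (by positivity)]
    have : κb * y.2.1 = shiftedShared κb b y + b * filterSum y := by
      rw [shiftedShared]; ring
    calc y.2.1 ^ 2 * κb ^ 2 = (κb * y.2.1) ^ 2 := by ring
      _ = (shiftedShared κb b y + b * filterSum y) ^ 2 := by rw [this]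
      _ ≤ _ := by
        linarith [sq_nonneg (shiftedShared κb b y - b * filterSum y),
          mul_nonneg (sq_nonneg b) (sq_nonneg (shiftedShared κb b y)), sq_nonneg (filterSum y)]
  have hF : ∀ i, a * y.1 (Sum.inl i) * (linearizedField w b k κ s a y).1 (Sum.inl i) +
      b * y.2.2 i * (linearizedField w b k κ s a y).2.2 i ≤
      a / w * s (Sum.inl i) ^ 2 * G ^ 2 + a / w * κ i ^ 2 * y.2.1 ^ 2 -
        (a * w / 2 * y.1 (Sum.inl i) ^ 2 + a * b * (y.1 (Sum.inl i) - y.2.2 i) ^ 2) := by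
    intro i
    simp only [linearizedField, Sum.elim_inl, ← hG]
    obtain ⟨r, hr⟩ : ∃ r, r = s (Sum.inl i) * G := ⟨_, rfl⟩
    obtain ⟨q, hq⟩ : ∃ q, q = κ i * y.2.1 := ⟨_, rfl⟩
    have e1 : y.1 (Sum.inl i) * (r - q) ≤ w / 2 * y.1 (Sum.inl i) ^ 2 + (r ^ 2 + q ^ 2) / w := by
      have h1 : 0 ≤ (w * y.1 (Sum.inl i) - (r - q)) ^ 2 + (r + q) ^ 2 := by positivity
      have h2 : w / 2 * y.1 (Sum.inl i) ^ 2 + (r ^ 2 + q ^ 2) / w - y.1 (Sum.inl i) * (r - q) =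
          ((w * y.1 (Sum.inl i) - (r - q)) ^ 2 + (r + q) ^ 2) / (2 * w) := by
        field_simp
        ring
      have h3 := div_nonneg h1 (by positivity : 0 ≤ 2 * w)
      linarith
    have e2 := mul_le_mul_of_nonneg_left e1 ha.le
    have e3 : a / w * s (Sum.inl i) ^ 2 * G ^ 2 + a / w * κ i ^ 2 * y.2.1 ^ 2 =
        a * ((r ^ 2 + q ^ 2) / w) := by
      rw [hr, hq]; field_simp
    rw [e3, ← hr, ← hq]
    linarith
  have hI : ∀ j, y.1 (Sum.inr j) * (linearizedField w b k κ s a y).1 (Sum.inr j) ≤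
      1 / (2 * w) * s (Sum.inr j) ^ 2 * G ^ 2 - w / 2 * y.1 (Sum.inr j) ^ 2 := by
    intro j
    simp only [linearizedField, Sum.elim_inr, ← hG]
    have h2 : 1 / (2 * w) * s (Sum.inr j) ^ 2 * G ^ 2 - w / 2 * y.1 (Sum.inr j) ^ 2 -
        y.1 (Sum.inr j) * -(w * y.1 (Sum.inr j) - s (Sum.inr j) * G) =
        (w * y.1 (Sum.inr j) - s (Sum.inr j) * G) ^ 2 / (2 * w) := by
      field_simp
      ring
    have h3 := div_nonneg (sq_nonneg (w * y.1 (Sum.inr j) - s (Sum.inr j) * G))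
      (by positivity : 0 ≤ 2 * w)
    linarith
  have hF' := Finset.sum_le_sum fun i (_ : i ∈ Finset.univ) => hF i
  have hI' := Finset.sum_le_sum fun j (_ : j ∈ Finset.univ) => hI j
  have sF : ∑ i, (a / w * s (Sum.inl i) ^ 2 * G ^ 2 + a / w * κ i ^ 2 * y.2.1 ^ 2) =
      a / w * (∑ i, s (Sum.inl i) ^ 2) * G ^ 2 + c₂ * y.2.1 ^ 2 := by
    rw [Finset.sum_add_distrib, hc₂]
    simp only [Finset.mul_sum, Finset.sum_mul]
  have sI : ∑ j, 1 / (2 * w) * s (Sum.inr j) ^ 2 * G ^ 2 =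
      1 / (2 * w) * (∑ j, s (Sum.inr j) ^ 2) * G ^ 2 := by
    simp only [Finset.mul_sum, Finset.sum_mul]
  rw [Finset.sum_sub_distrib, sF] at hF'
  rw [Finset.sum_sub_distrib, sI] at hI'
  have h1 : c₁ * G ^ 2 = a / w * (∑ i, s (Sum.inl i) ^ 2) * G ^ 2 +
      1 / (2 * w) * (∑ j, s (Sum.inr j) ^ 2) * G ^ 2 := by rw [hc₁]; ring
  have h2 := mul_le_mul_of_nonneg_left hφ hc₂0
  rw [← hG]
  have h3 : 0 ≤ c₁ * (shiftedShared κb b y ^ 2 + filterSum y ^ 2) := by positivity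
  have h4 : 0 ≤ c₂ * (2 * (1 + b ^ 2) / κb ^ 2) * G ^ 2 := by positivity
  linarith

/-- For slow filters the linearized closed loop has a quadratic Lyapunov function. -/
theorem exists_quadratic_lyapunov [Nonempty F] {w b k : ℝ} (hw : 0 < w) (hb : 0 < b) (hk : 0 < k)
    {κ : F → ℝ} (hκ : ∀ i, 0 < κ i) {s : F ⊕ I → ℝ} (hs : ∀ i, 0 ≤ s i) (hsw : ∑ i, s i ≤ w) :
    ∃ a₀ : ℝ, 0 < a₀ ∧ ∀ a : ℝ, 0 < a → a < a₀ →
      ∃ B : State F I →L[ℝ] State F I →L[ℝ] ℝ, (∀ x y, B x y = B y x) ∧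
        (∀ y, y ≠ 0 → 0 < B y y) ∧
        ∀ y, y ≠ 0 → B y (linearizedField w b k κ s a y) < 0 := by
  obtain ⟨κb, hκb⟩ : ∃ c, c = ∑ i, κ i := ⟨_, rfl⟩
  have hκ0 : 0 < ∑ i, κ i := Finset.sum_pos (fun i _ => hκ i) Finset.univ_nonempty
  have hκb0 : 0 < κb := hκb ▸ hκ0
  have hσ : 0 ≤ ∑ j, s (Sum.inr j) := Finset.sum_nonneg fun j _ => hs _
  have hσF : 0 ≤ ∑ i, s (Sum.inl i) := Finset.sum_nonneg fun j _ => hs _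
  have hss : ∑ i, s i = ∑ i, s (Sum.inl i) + ∑ j, s (Sum.inr j) := Fintype.sum_sum_type _
  obtain ⟨ε, a₀, ha₀, hpos, hker, hdec⟩ := aggregate_lyapunov (K := κb * k) (d := w - ∑ i, s i)
    hw hb (by positivity) (by linarith) hσ (by linarith)
  refine ⟨a₀, ha₀, fun a ha haa => ?_⟩
  obtain ⟨c, hc, hdec'⟩ := hdec a ha haa
  obtain ⟨D, hD, hind⟩ := individual_decay (b := b) (k := k) hw κ hκ0 s ha
  rw [← hκb] at hind
  -- The threshold `a₀` comes from the aggregates alone. `D` and `c` may depend on `a`, because this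
  -- weight is chosen after `a`; it turns the aggregate decay `c` into `D + 1`, which beats the
  -- coupling `D`.
  have hΛ : 0 < (D + 1) / c := by positivity
  refine ⟨cascadeForm ((D + 1) / c) (κb * k) (κb * k * b / w) ε a b κb,
    fun x y => cascadeForm_symm _ _ _ _ _ _ _ x y, fun y hy => ?_, fun y hy => ?_⟩
  · rw [cascadeForm_apply]
    have h1 := hpos (totalConductance y.1) (inflexibleConductance y) (shiftedShared κb b y)
    have h2 : 0 ≤ ∑ i, (a * y.1 (Sum.inl i) * y.1 (Sum.inl i) + b * y.2.2 i * y.2.2 i) :=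
      Finset.sum_nonneg fun i _ => by
        nlinarith [mul_nonneg ha.le (sq_nonneg (y.1 (Sum.inl i))),
          mul_nonneg hb.le (sq_nonneg (y.2.2 i))]
    have h3 : 0 ≤ ∑ j, y.1 (Sum.inr j) * y.1 (Sum.inr j) :=
      Finset.sum_nonneg fun i _ => mul_self_nonneg _
    by_contra hle
    have h4 : 0 ≤ (D + 1) / c * (κb * k * totalConductance y.1 ^ 2 +
        κb * k * b / w * inflexibleConductance y ^ 2 + shiftedShared κb b y ^ 2 +
        2 * ε * (totalConductance y.1 - 2 * inflexibleConductance y) * shiftedShared κb b y) :=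
      mul_nonneg hΛ.le h1
    have h5 : 0 ≤ (D + 1) / c * filterSum y ^ 2 := by positivity
    have e2 : ∑ i, (a * y.1 (Sum.inl i) * y.1 (Sum.inl i) + b * y.2.2 i * y.2.2 i) = 0 := by
      linarith
    have e3 : ∑ j, y.1 (Sum.inr j) * y.1 (Sum.inr j) = 0 := by linarith
    -- The diagonal terms control every `g i` and `ĝ i`, so only `η` must still be read off the
    -- aggregate form.
    have e4 := hker (totalConductance y.1) (inflexibleConductance y) (shiftedShared κb b y)
      (nonpos_of_mul_nonpos_right (by linarith) hΛ)
    rw [Finset.sum_eq_zero_iff_of_nonneg (fun i _ => by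
      nlinarith [mul_nonneg ha.le (sq_nonneg (y.1 (Sum.inl i))),
        mul_nonneg hb.le (sq_nonneg (y.2.2 i))])] at e2
    rw [Finset.sum_eq_zero_iff_of_nonneg (fun i _ => mul_self_nonneg _)] at e3
    refine hy (state_eq_zero hκb0.ne' (fun i => ?_) (fun j => ?_) (fun i => ?_) e4)
    · have h := e2 i (Finset.mem_univ i)
      by_contra h0
      have : 0 < a * y.1 (Sum.inl i) ^ 2 := by positivity
      nlinarith [mul_nonneg hb.le (sq_nonneg (y.2.2 i))]
    · simpa using e3 j (Finset.mem_univ j)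
    · have h := e2 i (Finset.mem_univ i)
      by_contra h0
      have : 0 < b * y.2.2 i ^ 2 := by positivity
      nlinarith [mul_nonneg ha.le (sq_nonneg (y.1 (Sum.inl i)))]
  · rw [cascadeForm_apply, linearizedField_totalConductance, linearizedField_inflexibleConductance,
      linearizedField_shiftedShared, linearizedField_filterSum, ← hκb]
    have h1 := hind y
    have h2 := mul_le_mul_of_nonneg_left (hdec' (totalConductance y.1) (inflexibleConductance y)
      (shiftedShared κb b y) (filterSum y)) hΛ.le
    have h3 : (D + 1) / c * (-c * (totalConductance y.1 ^ 2 + shiftedShared κb b y ^ 2 +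
        filterSum y ^ 2)) = -(D + 1) * (totalConductance y.1 ^ 2 + shiftedShared κb b y ^ 2 +
        filterSum y ^ 2) := by
      field_simp
    have hnF : ∀ i, 0 ≤ a * w / 2 * y.1 (Sum.inl i) ^ 2 +
        a * b * (y.1 (Sum.inl i) - y.2.2 i) ^ 2 := fun i => by positivity
    have hnI : ∀ j, 0 ≤ w / 2 * y.1 (Sum.inr j) ^ 2 := fun j => by positivity
    have h4 := Finset.sum_nonneg fun i (_ : i ∈ (Finset.univ : Finset F)) => hnF i
    have h5 := Finset.sum_nonneg fun j (_ : j ∈ (Finset.univ : Finset I)) => hnI j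
    have h6 := sq_nonneg (totalConductance y.1)
    have h7 := sq_nonneg (shiftedShared κb b y)
    have h8 := sq_nonneg (filterSum y)
    by_contra hge
    have h9 : totalConductance y.1 ^ 2 + shiftedShared κb b y ^ 2 + filterSum y ^ 2 +
        (∑ i, (a * w / 2 * y.1 (Sum.inl i) ^ 2 + a * b * (y.1 (Sum.inl i) - y.2.2 i) ^ 2) +
          ∑ j, w / 2 * y.1 (Sum.inr j) ^ 2) ≤ 0 := by
      linarith
    have e4 : shiftedShared κb b y = 0 := by
      have : shiftedShared κb b y ^ 2 = 0 := by linarith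
      simpa using this
    have e2 := (Finset.sum_eq_zero_iff_of_nonneg fun i _ => hnF i).1 (by linarith)
    have e3 := (Finset.sum_eq_zero_iff_of_nonneg fun j _ => hnI j).1 (by linarith)
    have e5 : ∀ i, y.1 (Sum.inl i) = 0 := fun i => by
      have h := e2 i (Finset.mem_univ i)
      by_contra h0
      have : 0 < a * w / 2 * y.1 (Sum.inl i) ^ 2 := by positivity
      have : 0 ≤ a * b * (y.1 (Sum.inl i) - y.2.2 i) ^ 2 := by positivity
      linarith
    refine hy (state_eq_zero hκb0.ne' e5 (fun j => ?_) (fun i => ?_) e4)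
    · have h := e3 j (Finset.mem_univ j)
      simpa [hw.ne'] using h
    · have h := e2 i (Finset.mem_univ i)
      rw [e5 i] at h
      simpa [ha.ne', hb.ne'] using h

end Cascade

namespace StarNetwork

/-! ### The power curve and its maximum -/

section PowerCurve

variable {F I : Type*} (S : StarNetwork F I)

theorem totalPower_eq_voltage_sq_mul (s : ℝ) : S.totalPower s = S.voltage s ^ 2 * s := by
  rw [totalPower, voltage, div_pow]

theorem voltage_pos (hE : 0 < S.E) (hgl : 0 < S.gl) {s : ℝ} (hs : 0 ≤ s) : 0 < S.voltage s := by
  unfold voltage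
  positivity

/-- The perfect square shows both that `Pmax` bounds the consumed power and that it is attained only
at `gl`. -/
theorem Pmax_sub_totalPower {s : ℝ} (hs : s + S.gl ≠ 0) :
    S.Pmax - S.totalPower s = S.E ^ 2 * S.gl * (S.gl - s) ^ 2 / (4 * (s + S.gl) ^ 2) := by
  rw [Pmax, totalPower]
  field_simp
  ring

theorem totalPower_gl (hgl : 0 < S.gl) : S.totalPower S.gl = S.Pmax := by
  have := S.Pmax_sub_totalPower (s := S.gl) (by linarith)
  simp at this
  linarith

theorem totalPower_le_Pmax (hgl : 0 < S.gl) {s : ℝ} (hs : 0 ≤ s) : S.totalPower s ≤ S.Pmax := by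
  have h1 := S.Pmax_sub_totalPower (s := s) (by linarith)
  have h2 : 0 ≤ S.E ^ 2 * S.gl * (S.gl - s) ^ 2 / (4 * (s + S.gl) ^ 2) := by positivity
  linarith

theorem eq_gl_of_totalPower_eq_Pmax (hE : 0 < S.E) (hgl : 0 < S.gl) {s : ℝ} (hs : 0 ≤ s)
    (h : S.totalPower s = S.Pmax) : s = S.gl := by
  have h1 := S.Pmax_sub_totalPower (s := s) (by linarith)
  have h2 : s + S.gl ≠ 0 := by linarith
  rw [h, sub_self, eq_comm] at h1
  simp [hE.ne', hgl.ne', h2, sub_eq_zero] at h1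
  exact h1.symm

/-- After cross-multiplication, equality of powers reads `(s - t) (gl² - s t) = 0`, and `s t < gl²`
on this range. -/
theorem totalPower_injective_below (hE : 0 < S.E) (hgl : 0 < S.gl) {s t : ℝ} (hs : 0 ≤ s)
    (ht : 0 ≤ t) (hsl : s < S.gl) (htl : t ≤ S.gl) (h : S.totalPower s = S.totalPower t) :
    s = t := by
  have hC : (S.E * S.gl) ^ 2 ≠ 0 := by positivity
  have hs' : s + S.gl ≠ 0 := by linarith
  have ht' : t + S.gl ≠ 0 := by linarith
  rw [totalPower, totalPower, div_mul_eq_mul_div, div_mul_eq_mul_div,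
    div_eq_div_iff (pow_ne_zero 2 hs') (pow_ne_zero 2 ht')] at h
  have h1 : s * (t + S.gl) ^ 2 = t * (s + S.gl) ^ 2 :=
    mul_left_cancel₀ hC (by linear_combination h)
  have h2 : (s - t) * (S.gl ^ 2 - s * t) = 0 := by linear_combination h1
  have h3 : S.gl ^ 2 - s * t ≠ 0 := by
    have : s * t ≤ s * S.gl := by gcongr
    have : s * S.gl < S.gl * S.gl := by gcongr
    nlinarith
  exact sub_eq_zero.1 ((mul_eq_zero.1 h2).resolve_right h3)

theorem κbar_pos [Fintype F] [Nonempty F] (hκ : ∀ i, 0 < S.κ i) : 0 < S.κbar :=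
  Finset.sum_pos (fun i _ => hκ i) Finset.univ_nonempty

end PowerCurve

/-! ### Derivatives of the aggregate power mismatch -/

section TotalDemand

variable {F I : Type*} [Fintype F] [Fintype I] (S : StarNetwork F I)

theorem totalConductance_nonneg {g : F ⊕ I → ℝ} (hg : ∀ i, 0 ≤ g i) : 0 ≤ totalConductance g :=
  Finset.sum_nonneg fun i _ => hg i

theorem continuous_totalConductance :
    Continuous (totalConductance : (F ⊕ I → ℝ) → ℝ) := by
  unfold totalConductance
  fun_prop

theorem sum_deltaP (g : F ⊕ I → ℝ) :
    ∑ i, S.deltaP g i = S.totalDeltaP (totalConductance g) := by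
  simp only [deltaP, totalDeltaP, totalDemand, Finset.sum_sub_distrib, S.sum_power]

theorem hasDerivAt_totalDeltaP {s : ℝ} (hs : s + S.gl ≠ 0) :
    HasDerivAt S.totalDeltaP ((S.E * S.gl) ^ 2 * (S.gl - s) / (s + S.gl) ^ 3) s := by
  have h1 : HasDerivAt (fun t : ℝ => (t + S.gl) ^ 2) (2 * (s + S.gl)) s := by
    simpa using ((hasDerivAt_id s).add_const S.gl).fun_pow 2
  have h2 := ((((hasDerivAt_const s ((S.E * S.gl) ^ 2)).div h1 (pow_ne_zero 2 hs)).mul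
    (hasDerivAt_id s)).sub_const S.totalDemand)
  refine h2.congr_deriv ?_
  simp only [id, Pi.div_apply]
  field_simp
  ring

theorem deriv_totalDeltaP {s : ℝ} (hs : s + S.gl ≠ 0) :
    deriv S.totalDeltaP s = (S.E * S.gl) ^ 2 * (S.gl - s) / (s + S.gl) ^ 3 :=
  (S.hasDerivAt_totalDeltaP hs).deriv

theorem deriv_totalDeltaP_eventuallyEq {s : ℝ} (hs : s + S.gl ≠ 0) :
    deriv S.totalDeltaP =ᶠ[𝓝 s] fun t => (S.E * S.gl) ^ 2 * (S.gl - t) / (t + S.gl) ^ 3 := by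
  have : ∀ᶠ t in 𝓝 s, t + S.gl ≠ 0 :=
    (continuous_id.add continuous_const).continuousAt.eventually_ne hs
  filter_upwards [this] with t ht
  exact S.deriv_totalDeltaP ht

/-- The derivative of the right-hand side of the shared state's equation. -/
def sharedGain (s : ℝ) : ℝ :=
  ((S.E * S.gl) ^ 2 * (S.gl - s) / (s + S.gl) ^ 3) ^ 2 +
    S.totalDeltaP s * ((S.E * S.gl) ^ 2 * (2 * s - 4 * S.gl) / (s + S.gl) ^ 4)

theorem hasDerivAt_totalDeltaP_mul_deriv {s : ℝ} (hs : s + S.gl ≠ 0) :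
    HasDerivAt (fun t => S.totalDeltaP t * deriv S.totalDeltaP t) (S.sharedGain s) s := by
  have h1 : HasDerivAt (fun t : ℝ => (t + S.gl) ^ 3) (3 * (s + S.gl) ^ 2) s := by
    simpa using ((hasDerivAt_id s).add_const S.gl).fun_pow 3
  have h2 := ((((hasDerivAt_id s).const_sub S.gl).const_mul ((S.E * S.gl) ^ 2)).div h1
    (pow_ne_zero 3 hs)).congr_of_eventuallyEq (S.deriv_totalDeltaP_eventuallyEq hs)
  refine ((S.hasDerivAt_totalDeltaP hs).mul h2).congr_deriv ?_
  rw [S.deriv_totalDeltaP hs, sharedGain]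
  simp only [id]
  field_simp
  ring

theorem contDiffAt_totalDeltaP_mul_deriv {s : ℝ} (hs : s + S.gl ≠ 0) :
    ContDiffAt ℝ 1 (fun t => S.totalDeltaP t * deriv S.totalDeltaP t) s := by
  have h1 : ContDiffAt ℝ 1 (fun t : ℝ => t + S.gl) s := contDiffAt_id.add contDiffAt_const
  have h2 : ContDiffAt ℝ 1 (deriv S.totalDeltaP) s := by
    refine ContDiffAt.congr_of_eventuallyEq ?_ (S.deriv_totalDeltaP_eventuallyEq hs)
    exact (contDiffAt_const.mul (contDiffAt_const.sub contDiffAt_id)).div (h1.pow 3)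
      (pow_ne_zero 3 hs)
  have h3 : ContDiffAt ℝ 1 S.totalDeltaP s :=
    ((contDiffAt_const.div (h1.pow 2) (pow_ne_zero 2 hs)).mul contDiffAt_id).sub contDiffAt_const
  exact h3.mul h2

end TotalDemand

/-! ### Smoothness and linearization of the closed loop -/

section Linearization

variable {F I : Type*} [Fintype F] [Fintype I] (S : StarNetwork F I)

theorem contDiffAt_vcsField (a b : ℝ) {p : State F I} (hp : totalConductance p.1 + S.gl ≠ 0) :
    ContDiffAt ℝ 1 (S.vcsField a b) p := by
  have hG : ContDiffAt ℝ 1 (fun x : State F I => totalConductance x.1) p := by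
    unfold totalConductance
    fun_prop
  have hv : ContDiffAt ℝ 1 (fun x : State F I => S.voltage (totalConductance x.1)) p := by
    unfold voltage
    exact contDiffAt_const.div (hG.add contDiffAt_const) hp
  have hd : ∀ i, ContDiffAt ℝ 1 (fun x : State F I => S.deltaP x.1 i) p := fun i => by
    unfold deltaP power
    exact ((hv.pow 2).mul (by fun_prop)).sub contDiffAt_const
  refine ContDiffAt.prodMk (contDiffAt_pi.2 fun i => ?_) (ContDiffAt.prodMk ?_ ?_)
  · cases i with
    | inl i =>
      simp only [Sum.elim_inl]
      exact ((hd _).neg.sub (by fun_prop)).add (by fun_prop)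
    | inr j =>
      simp only [Sum.elim_inr]
      exact (hd _).neg
  · exact (S.contDiffAt_totalDeltaP_mul_deriv hp).comp p hG
  · fun_prop

/-- The linearization of the closed loop. -/
theorem fderiv_vcsField (a b : ℝ) {p : State F I} (hp : totalConductance p.1 + S.gl ≠ 0)
    (y : State F I) :
    fderiv ℝ (S.vcsField a b) p y =
      linearizedField (S.voltage (totalConductance p.1) ^ 2) b
        (S.sharedGain (totalConductance p.1)) S.κ
        (fun i => 2 * S.voltage (totalConductance p.1) ^ 2 * p.1 i /
          (totalConductance p.1 + S.gl)) a y := by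
  have hdiff := (S.contDiffAt_vcsField a b hp).differentiableAt one_ne_zero
  -- Differentiability reduces the Fréchet derivative to one-variable calculus along `p + t • y`.
  rw [← hdiff.lineDeriv_eq_fderiv]
  refine HasLineDerivAt.lineDeriv ?_
  obtain ⟨s, hs⟩ : ∃ s, s = totalConductance p.1 := ⟨_, rfl⟩
  have hline : ∀ t : ℝ, totalConductance (p + t • y).1 = s + t * totalConductance y.1 := by
    intro t
    simp only [hs, totalConductance, Prod.fst_add, Prod.smul_fst, Pi.add_apply, Pi.smul_apply,
      smul_eq_mul, Finset.sum_add_distrib, Finset.mul_sum]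
  have aff : ∀ u v : ℝ, HasDerivAt (fun t : ℝ => u + t * v) v 0 := fun u v => by
    simpa using ((hasDerivAt_id (0 : ℝ)).mul_const v).const_add u
  rw [← hs] at hp ⊢
  have hv : HasDerivAt (fun t : ℝ => S.voltage (totalConductance (p + t • y).1))
      (-(S.voltage s * totalConductance y.1 / (s + S.gl))) 0 := by
    simp only [hline, voltage]
    have h := (hasDerivAt_const (0 : ℝ) (S.E * S.gl)).div
      ((aff s (totalConductance y.1)).add_const S.gl) (by simpa using hp)
    refine h.congr_deriv ?_
    simp only [zero_mul, add_zero]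
    field_simp
    ring
  have hv0 : S.voltage (totalConductance (p + (0 : ℝ) • y).1) = S.voltage s := by
    rw [hline]; simp
  have hd : ∀ i, HasDerivAt (fun t : ℝ => S.deltaP (p + t • y).1 i)
      (S.voltage s ^ 2 * y.1 i -
        2 * S.voltage s ^ 2 * p.1 i / (s + S.gl) * totalConductance y.1) 0 := fun i => by
    have h := ((hv.pow 2).mul (aff (p.1 i) (y.1 i))).sub_const (S.P0 i)
    refine h.congr_deriv ?_
    simp only [Pi.pow_apply, hv0]
    simp
    field_simp
    ring
  refine HasDerivAt.prodMk (hasDerivAt_pi.2 fun i => ?_) (HasDerivAt.prodMk ?_ ?_)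
  · cases i with
    | inl i =>
      simp only [Sum.elim_inl]
      exact ((hd _).neg.sub ((aff p.2.1 y.2.1).const_mul (S.κ i))).add
        (((aff (p.2.2 i) (y.2.2 i)).sub (aff (p.1 (Sum.inl i)) (y.1 (Sum.inl i)))).const_mul b)
    | inr j =>
      simp only [Sum.elim_inr]
      exact (hd _).neg
  · simp only [hline]
    have h := S.hasDerivAt_totalDeltaP_mul_deriv hp
    have h' : HasDerivAt (fun t => S.totalDeltaP t * deriv S.totalDeltaP t) (S.sharedGain s)
        (s + 0 * totalConductance y.1) := by simpa using h
    exact h'.comp (0 : ℝ) (aff s (totalConductance y.1))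
  · exact hasDerivAt_pi.2 fun i =>
      ((aff (p.2.2 i) (y.2.2 i)).sub (aff (p.1 (Sum.inl i)) (y.1 (Sum.inl i)))).const_mul (-a)

/-- An equilibrium with total conductance at most `g_l` and positive gain of the shared state is
locally asymptotically stable when the filters are slow enough. -/
theorem exists_isLocallyAsymptoticallyStable [Nonempty F] (hE : 0 < S.E) (hgl : 0 < S.gl)
    (hκ : ∀ i, 0 < S.κ i) {b : ℝ} (hb : 0 < b) {p : State F I} (hp : ∀ i, 0 ≤ p.1 i)
    (hpl : totalConductance p.1 ≤ S.gl) (hgain : 0 < S.sharedGain (totalConductance p.1))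
    (heq : ∀ a, a ≠ 0 → S.vcsField a b p = 0) :
    ∃ a₀ : ℝ, 0 < a₀ ∧ ∀ a : ℝ, 0 < a → a < a₀ →
      IsLocallyAsymptoticallyStable (S.vcsField a b) p := by
  have hs := totalConductance_nonneg hp
  have hv := S.voltage_pos hE hgl hs
  have hne : totalConductance p.1 + S.gl ≠ 0 := by linarith
  obtain ⟨a₀, ha₀, h⟩ := exists_quadratic_lyapunov (w := S.voltage (totalConductance p.1) ^ 2)
    (s := fun i => 2 * S.voltage (totalConductance p.1) ^ 2 * p.1 i /
      (totalConductance p.1 + S.gl)) (by positivity) hb hgain hκ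
    (fun i => by have := hp i; positivity) (by
      -- The bound on the summed sensitivities amounts to `2 ḡ ≤ ḡ + gl`, which is where `ḡ ≤ gl`
      -- enters.
      rw [← Finset.sum_div, ← Finset.mul_sum]
      change 2 * S.voltage (totalConductance p.1) ^ 2 * totalConductance p.1 / _ ≤ _
      rw [div_le_iff₀ (by positivity)]
      nlinarith [sq_nonneg (S.voltage (totalConductance p.1))])
  refine ⟨a₀, ha₀, fun a ha haa => ?_⟩
  obtain ⟨B, hsymm, hpos, hneg⟩ := h a ha haa
  refine isLocallyAsymptoticallyStable_of_quadratic (S.contDiffAt_vcsField a b hne)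
    (heq a ha.ne') B hsymm hpos fun y hy => ?_
  rw [S.fderiv_vcsField a b hne]
  exact hneg y hy

end Linearization

/-! ### Equilibria, uniqueness and the sign of the gain -/

section Equilibria

variable {F I : Type*} [Fintype F] [Fintype I] (S : StarNetwork F I)

theorem conductance_eq_of_deltaP_eq (hE : 0 < S.E) (hgl : 0 < S.gl) {g g' : F ⊕ I → ℝ}
    (hg : ∀ i, 0 ≤ g i) (htot : totalConductance g = totalConductance g')
    (h : ∀ i, S.deltaP g i = S.deltaP g' i) : g = g' := by
  funext i
  have h1 := h i
  have h2 := (S.voltage_pos hE hgl (totalConductance_nonneg hg)).ne'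
  rw [deltaP, deltaP, power, power, ← htot, sub_left_inj] at h1
  exact mul_left_cancel₀ (pow_ne_zero 2 h2) h1

theorem vcsField_eq_zero_iff {a : ℝ} (ha : a ≠ 0) (b : ℝ) (x : State F I) :
    S.vcsField a b x = 0 ↔
      (∀ i, S.deltaP x.1 (Sum.inl i) = -S.κ i * x.2.1) ∧ (∀ j, S.deltaP x.1 (Sum.inr j) = 0) ∧
      S.totalDeltaP (totalConductance x.1) * deriv S.totalDeltaP (totalConductance x.1) = 0 ∧
      ∀ i, x.2.2 i = x.1 (Sum.inl i) := by
  constructor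
  · intro h
    have h1 := congrArg Prod.fst h
    have h2 : ∀ i, x.2.2 i = x.1 (Sum.inl i) := fun i => by
      have : -a * (x.2.2 i - x.1 (Sum.inl i)) = 0 := congrFun (congrArg (fun z => z.2.2) h) i
      exact sub_eq_zero.1 ((mul_eq_zero.1 this).resolve_left (neg_ne_zero.2 ha))
    refine ⟨fun i => ?_, fun j => ?_, congrArg (fun z => z.2.1) h, h2⟩
    · have : -S.deltaP x.1 (Sum.inl i) - S.κ i * x.2.1 + b * (x.2.2 i - x.1 (Sum.inl i)) = 0 :=
        congrFun h1 (Sum.inl i)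
      rw [h2 i] at this
      linarith
    · have : -S.deltaP x.1 (Sum.inr j) = 0 := congrFun h1 (Sum.inr j)
      linarith
  · rintro ⟨h1, h2, h3, h4⟩
    refine Prod.ext (funext fun i => ?_) (Prod.ext h3 (funext fun i => ?_))
    · cases i with
      | inl i => simp [vcsField, h1, h4]
      | inr j => simp [vcsField, h2]
    · simp [vcsField, h4]

theorem sum_deltaP_of_proportional [Nonempty F] (hκ : ∀ i, 0 < S.κ i) {g : F ⊕ I → ℝ} {φ : ℝ}
    (hF : ∀ i, S.deltaP g (Sum.inl i) = S.κ i / S.κbar * φ)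
    (hI : ∀ j, S.deltaP g (Sum.inr j) = 0) : S.totalDeltaP (totalConductance g) = φ := by
  have hκb := (S.κbar_pos hκ).ne'
  rw [← S.sum_deltaP, Fintype.sum_sum_type]
  simp only [hF, hI, Finset.sum_const_zero, add_zero, ← Finset.sum_mul, ← Finset.sum_div]
  change S.κbar / S.κbar * φ = φ
  rw [div_self hκb, one_mul]

/-- The shares `κ i / κ̄` sum to one, so the total power is `Pmax`, attained only at `gl`. -/
theorem totalConductance_of_proportionalAllocation [Nonempty F] (hE : 0 < S.E) (hgl : 0 < S.gl)
    (hκ : ∀ i, 0 < S.κ i) {x : State F I} (hx : x ∈ S.proportionalAllocation) :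
    totalConductance x.1 = S.gl := by
  obtain ⟨h0, hF, hI, -, -⟩ := hx
  have h := S.sum_deltaP_of_proportional hκ hF hI
  rw [totalDeltaP] at h
  exact S.eq_gl_of_totalPower_eq_Pmax hE hgl (totalConductance_nonneg h0) (by linarith)

theorem proportionalAllocation_subsingleton [Nonempty F] (hE : 0 < S.E) (hgl : 0 < S.gl)
    (hκ : ∀ i, 0 < S.κ i) : S.proportionalAllocation.Subsingleton := by
  intro x hx y hy
  have htot : totalConductance x.1 = totalConductance y.1 := by
    rw [S.totalConductance_of_proportionalAllocation hE hgl hκ hx,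
      S.totalConductance_of_proportionalAllocation hE hgl hκ hy]
  obtain ⟨h0, hF, hI, hφ, hh⟩ := hx
  obtain ⟨-, hF', hI', hφ', hh'⟩ := hy
  have hg : x.1 = y.1 := S.conductance_eq_of_deltaP_eq hE hgl h0 htot fun i => by
    cases i with
    | inl i => rw [hF, hF']
    | inr j => rw [hI, hI']
  refine Prod.ext hg (Prod.ext (hφ.trans hφ'.symm) (funext fun i => ?_))
  rw [hh, hh', hg]

theorem proportionalAllocation_nonempty [Nonempty F] (hE : 0 < S.E) (hgl : 0 < S.gl)
    (hκ : ∀ i, 0 < S.κ i) (hI : ∀ j : I, 0 < S.P0 (Sum.inr j))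
    (hshed : ∀ i : F, S.κ i / S.κbar * (S.totalDemand - S.Pmax) ≤ S.P0 (Sum.inl i)) :
    S.proportionalAllocation.Nonempty := by
  have hκb := (S.κbar_pos hκ).ne'
  -- At total conductance `gl` the voltage is `E / 2`, so dividing the allotted powers `q` by `E² /
  -- 4` gives the conductances.
  have hw : 0 < S.E ^ 2 / 4 := by positivity
  let q : F ⊕ I → ℝ :=
    Sum.elim (fun i => S.P0 (Sum.inl i) + S.κ i / S.κbar * (S.Pmax - S.totalDemand))
      (fun j => S.P0 (Sum.inr j))
  have hq : ∑ i, q i = S.Pmax := by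
    have h1 : S.totalDemand = ∑ i, S.P0 (Sum.inl i) + ∑ j, S.P0 (Sum.inr j) :=
      Fintype.sum_sum_type _
    have h2 : ∑ i, S.κ i / S.κbar * (S.Pmax - S.totalDemand) = S.Pmax - S.totalDemand := by
      rw [← Finset.sum_mul, ← Finset.sum_div]
      change S.κbar / S.κbar * _ = _
      rw [div_self hκb, one_mul]
    rw [Fintype.sum_sum_type]
    simp only [q, Sum.elim_inl, Sum.elim_inr, Finset.sum_add_distrib, h2]
    linarith
  have hq0 : ∀ i, 0 ≤ q i := fun i => by
    cases i with
    | inl i =>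
      have := hshed i
      simp only [q, Sum.elim_inl]
      linarith
    | inr j => exact (hI j).le
  let g : F ⊕ I → ℝ := fun i => q i / (S.E ^ 2 / 4)
  have htot : totalConductance g = S.gl := by
    simp only [totalConductance, g, ← Finset.sum_div, hq, Pmax]
    field_simp
  have hP : ∀ i, S.power g i = q i := fun i => by
    rw [power, htot, voltage]
    simp only [g]
    field_simp
    ring
  refine ⟨(g, (S.totalDemand - S.Pmax) / S.κbar, fun i => g (Sum.inl i)),
    fun i => div_nonneg (hq0 i) hw.le, fun i => ?_, fun j => ?_, rfl, fun i => rfl⟩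
  · simp [deltaP, hP, q]
  · simp [deltaP, hP, q]

theorem equilibria_eq_proportionalAllocation [Nonempty F] (hE : 0 < S.E) (hgl : 0 < S.gl)
    (hκ : ∀ i, 0 < S.κ i) (hD : S.Pmax < S.totalDemand) {a : ℝ} (ha : a ≠ 0) (b : ℝ) :
    S.equilibria a b = S.proportionalAllocation := by
  have hκb := (S.κbar_pos hκ).ne'
  ext x
  constructor
  · rintro ⟨h0, h⟩
    obtain ⟨hF, hI, hφ, hh⟩ := (S.vcsField_eq_zero_iff ha b x).1 h
    have hs := totalConductance_nonneg h0
    -- Demand above capacity leaves a nonzero mismatch at every `g ≥ 0`, so the slope factor must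
    -- vanish.
    have hlt : S.totalDeltaP (totalConductance x.1) ≠ 0 := by
      have := S.totalPower_le_Pmax hgl hs
      rw [totalDeltaP]
      linarith
    have hne : totalConductance x.1 + S.gl ≠ 0 := by linarith
    have hd := (mul_eq_zero.1 hφ).resolve_left hlt
    rw [S.deriv_totalDeltaP hne] at hd
    have hgbar : totalConductance x.1 = S.gl := by
      simp [hE.ne', hgl.ne', hne, sub_eq_zero] at hd
      exact hd.symm
    have hφ' : S.totalDeltaP (totalConductance x.1) = -S.κbar * x.2.1 :=
      S.sum_deltaP_of_proportional hκ (fun i => by rw [hF i]; field_simp) hI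
    have hφ'' : x.2.1 = (S.totalDemand - S.Pmax) / S.κbar := by
      rw [hgbar, totalDeltaP, S.totalPower_gl hgl] at hφ'
      field_simp
      linarith
    refine ⟨h0, fun i => ?_, hI, hφ'', hh⟩
    rw [hF i, hφ'']
    ring
  · intro hx
    have hgbar := S.totalConductance_of_proportionalAllocation hE hgl hκ hx
    obtain ⟨h0, hF, hI, hφ, hh⟩ := hx
    refine ⟨h0, (S.vcsField_eq_zero_iff ha b x).2 ⟨fun i => ?_, hI, ?_, hh⟩⟩
    · rw [hF, hφ]
      ring
    · rw [hgbar, S.deriv_totalDeltaP (by linarith)]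
      simp

/-- The slope vanishes at `gl`, leaving the mismatch times the second derivative, both negative. -/
theorem sharedGain_gl_pos (hE : 0 < S.E) (hgl : 0 < S.gl) (hD : S.Pmax < S.totalDemand) :
    0 < S.sharedGain S.gl := by
  have h1 : S.sharedGain S.gl = (S.totalDemand - S.Pmax) * (S.E ^ 2 / (8 * S.gl)) := by
    rw [sharedGain, totalDeltaP, S.totalPower_gl hgl]
    field_simp
    ring
  rw [h1]
  have : 0 < S.totalDemand - S.Pmax := by linarith
  positivity

/-- With zero mismatch only the squared slope remains, nonzero below `gl`. -/
theorem sharedGain_pos_of_lt (hE : 0 < S.E) (hgl : 0 < S.gl) {s : ℝ} (hs : 0 ≤ s) (hsl : s < S.gl)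
    (h : S.totalDeltaP s = 0) : 0 < S.sharedGain s := by
  have : 0 < S.gl - s := by linarith
  rw [sharedGain, h, zero_mul, add_zero]
  positivity

theorem totalConductance_le_of_mem_closure {g : F ⊕ I → ℝ} (hg : g ∈ closure S.regionM) :
    totalConductance g ≤ S.gl :=
  closure_minimal (t := {g | totalConductance g ≤ S.gl}) (fun _ h => h.2.le)
    (isClosed_le continuous_totalConductance continuous_const) hg

/-- Feasible demand is satisfied at exactly one point with total conductance at most `g_l`. -/
theorem exists_loadSatisfaction (hE : 0 < S.E) (hgl : 0 < S.gl) (hP0 : ∀ i, 0 ≤ S.P0 i)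
    (hD : S.totalDemand < S.Pmax) :
    ∃ p : State F I, S.loadSatisfaction ∩ {x | x.1 ∈ closure S.regionM} = {p} ∧
      p.1 ∈ S.regionM ∧ p ∈ S.loadSatisfaction := by
  have hcont : ContinuousOn S.totalDeltaP (Icc 0 S.gl) := fun s hs =>
    (S.hasDerivAt_totalDeltaP (by linarith [hs.1])).continuousAt.continuousWithinAt
  have hD0 : 0 ≤ S.totalDemand := Finset.sum_nonneg fun i _ => hP0 i
  obtain ⟨s, hs, hs0⟩ := intermediate_value_Icc hgl.le hcont (show (0 : ℝ) ∈ Icc _ _ by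
    constructor
    · simp [totalDeltaP, totalPower, hD0]
    · rw [totalDeltaP, S.totalPower_gl hgl]
      linarith)
  have hsP : S.totalPower s = S.totalDemand := sub_eq_zero.1 hs0
  have hsl : s < S.gl := lt_of_le_of_ne hs.2 fun h => by
    rw [h, S.totalPower_gl hgl] at hsP
    linarith
  have hv := S.voltage_pos hE hgl hs.1
  let g : F ⊕ I → ℝ := fun i => S.P0 i / S.voltage s ^ 2
  have hg0 : ∀ i, 0 ≤ g i := fun i => div_nonneg (hP0 i) (sq_nonneg _)
  have htot : totalConductance g = s := by
    simp only [totalConductance, g, ← Finset.sum_div]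
    change S.totalDemand / _ = s
    rw [← hsP, S.totalPower_eq_voltage_sq_mul]
    field_simp
  have hgP : ∀ i, S.deltaP g i = 0 := fun i => by
    rw [deltaP, power, htot]
    simp only [g]
    field_simp
    ring
  have hgM : g ∈ S.regionM := ⟨hg0, htot ▸ hsl⟩
  have hmem : ((g, 0, fun i => g (Sum.inl i)) : State F I) ∈ S.loadSatisfaction :=
    ⟨hg0, hgP, rfl, fun i => rfl⟩
  refine ⟨(g, 0, fun i => g (Sum.inl i)), Set.eq_singleton_iff_unique_mem.2
    ⟨⟨hmem, subset_closure hgM⟩, ?_⟩, hgM, hmem⟩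
  rintro x ⟨⟨h0, hP, hφ, hh⟩, hcl⟩
  have hle := S.totalConductance_le_of_mem_closure hcl
  have hx : S.totalPower (totalConductance x.1) = S.totalDemand := by
    have := S.sum_deltaP x.1
    simp only [hP, Finset.sum_const_zero, totalDeltaP] at this
    linarith
  have hxs : totalConductance x.1 = totalConductance g := by
    rw [htot]
    exact (S.totalPower_injective_below hE hgl hs.1 (totalConductance_nonneg h0) hsl hle
      (hsP.trans hx.symm)).symm
  have hxg : x.1 = g := S.conductance_eq_of_deltaP_eq hE hgl h0 hxs fun i => by rw [hP, hgP]
  refine Prod.ext hxg (Prod.ext hφ (funext fun i => ?_))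
  rw [hh, hxg]

theorem vcsField_eq_zero_of_loadSatisfaction {x : State F I} (hx : x ∈ S.loadSatisfaction)
    (a b : ℝ) : S.vcsField a b x = 0 := by
  obtain ⟨-, hP, hφ, hh⟩ := hx
  have h0 := S.sum_deltaP x.1
  simp only [hP, Finset.sum_const_zero] at h0
  refine Prod.ext (funext fun i => ?_) (Prod.ext ?_ (funext fun i => ?_))
  · cases i with
    | inl i => simp [vcsField, hP, hφ, hh]
    | inr j => simp [vcsField, hP]
  · simp [vcsField, ← h0]
  · simp [vcsField, hh]

end Equilibria

end StarNetwork

end StarDC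

end

/-! ### Assembly of the two regimes -/

theorem theorem5 {F I : Type*} [Fintype F] [Fintype I] [Nonempty F]
    (S : StarDC.StarNetwork F I) (hE : 0 < S.E) (hgl : 0 < S.gl)
    (hF : ∀ i : F, 0 ≤ S.P0 (Sum.inl i)) (hI : ∀ j : I, 0 < S.P0 (Sum.inr j))
    (hκ : ∀ i : F, 0 < S.κ i) (b : ℝ) (hb : 0 < b) :
    ∃ a₀ : ℝ, 0 < a₀ ∧ ∀ a : ℝ, 0 < a → a < a₀ →
      (S.Pmax < S.totalDemand →
        (∀ i : F, S.κ i / S.κbar * (S.totalDemand - S.Pmax) ≤ S.P0 (Sum.inl i)) →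
        ∃ p : StarDC.State F I,
          S.proportionalAllocation = {p} ∧
          S.equilibria a b = {p} ∧
          StarDC.IsLocallyAsymptoticallyStable (S.vcsField a b) p) ∧
      (S.totalDemand < S.Pmax →
        ∃ p : StarDC.State F I,
          S.loadSatisfaction ∩ {x | x.1 ∈ closure S.regionM} = {p} ∧
          p.1 ∈ S.regionM ∧
          StarDC.IsLocallyAsymptoticallyStable (S.vcsField a b) p) := by
  have hP0 : ∀ i, 0 ≤ S.P0 i := fun i => by
    cases i with
    | inl i => exact hF i
    | inr j => exact (hI j).le
  -- The regimes exclude each other, and each equilibrium is independent of `a`, so `a₀` is chosen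
  -- separately in each case.
  rcases lt_or_ge S.totalDemand S.Pmax with hD | hD
  · obtain ⟨p, hp, hpM, hpL⟩ := S.exists_loadSatisfaction hE hgl hP0 hD
    have hzero : S.totalDeltaP (StarDC.StarNetwork.totalConductance p.1) = 0 := by
      rw [← S.sum_deltaP]
      exact Finset.sum_eq_zero fun i _ => hpL.2.1 i
    obtain ⟨a₀, ha₀, h⟩ := S.exists_isLocallyAsymptoticallyStable hE hgl hκ hb hpM.1 hpM.2.le
      (S.sharedGain_pos_of_lt hE hgl (StarDC.StarNetwork.totalConductance_nonneg hpM.1) hpM.2 hzero)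
      (fun a _ => S.vcsField_eq_zero_of_loadSatisfaction hpL a b)
    exact ⟨a₀, ha₀, fun a ha haa => ⟨fun hD' => absurd hD' hD.not_gt,
      fun _ => ⟨p, hp, hpM, h a ha haa⟩⟩⟩
  · by_cases hcase : S.Pmax < S.totalDemand ∧
      ∀ i : F, S.κ i / S.κbar * (S.totalDemand - S.Pmax) ≤ S.P0 (Sum.inl i)
    · obtain ⟨p, hp⟩ := S.proportionalAllocation_nonempty hE hgl hκ hI hcase.2
      have hset : S.proportionalAllocation = {p} :=
        (S.proportionalAllocation_subsingleton hE hgl hκ).eq_singleton_of_mem hp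
      have hgbar := S.totalConductance_of_proportionalAllocation hE hgl hκ hp
      have hequi : ∀ a : ℝ, a ≠ 0 → S.equilibria a b = {p} := fun a ha =>
        (S.equilibria_eq_proportionalAllocation hE hgl hκ hcase.1 ha b).trans hset
      -- Total conductance `gl` is the borderline case: the sensitivities sum exactly to the squared
      -- voltage, so `d = 0` in the aggregate system.
      obtain ⟨a₀, ha₀, h⟩ := S.exists_isLocallyAsymptoticallyStable hE hgl hκ hb hp.1 hgbar.le
        (hgbar.symm ▸ S.sharedGain_gl_pos hE hgl hcase.1)
        fun a ha => (show p ∈ S.equilibria a b from hequi a ha ▸ rfl).2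
      exact ⟨a₀, ha₀, fun a ha haa => ⟨fun _ _ => ⟨p, hset, hequi a ha.ne', h a ha haa⟩,
        fun hD' => absurd hD' hD.not_gt⟩⟩
    -- Demand equal to capacity, or insufficient flexible demand: both claims are vacuous and any
    -- `a₀` serves.
    · exact ⟨1, one_pos, fun a _ _ => ⟨fun h1 h2 => absurd ⟨h1, h2⟩ hcase,
        fun hD' => absurd hD' hD.not_gt⟩⟩
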